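/- The lucky numbers are produced by the following sieve. Let $\mathcal L_1$ be the set of all positive integers and let $\mathcal L_2$ consist of $2$ and all odd integers $\ge 3$. Write $\ell_{m,1}<\ell_{m,2}<\cdots$ for the elements of $\mathcal L_m$ in increasing order and, for $m\ge 2$, let $\mathcal L_{m+1}$ consist of all $\ell_{m,n}$ such that $n$ is a positive integer not divisible by $\ell_{m,m}$. Put $\ell_1:=2$ and $\ell_n:=\ell_{n,n}$ for $n\ge 2$; so $(\ell_n)_{n\ge 1}=2,3,7,9,13,15,21,25,31,33,\dots$, and for $n \geq 2$ the integer $\ell_n$ is the $n$th lucky number (the first lucky number is usually taken to be $1$ instead of $2$). Let $\log$ denote the natural logarithm. Theorem. The inequality \[ \ell_n < n\left(\log n + \tfrac12(\log\log n)^2 + 1\right) \] holds for all integers $n$ with $4\le n\le 10^7$; and the inequality \[ \ell_n < n\left(\log n + \tfrac12(\log\log n)^2 + C_2\log\log n + C_4\right), \qquad C_2 = 1.238645,\quad C_4 = 3.015516, \] holds for all integers $n > 10^7$. -/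

import Mathlib

/-- The sets `𝓛₁ ⊇ …` of the lucky number sieve. `𝓛₁` is the set of all positive integers,
`𝓛₂` consists of `2` and of all odd integers `≥ 3`, and for `m ≥ 2` the set `𝓛ₘ₊₁` is obtained from
`𝓛ₘ = {ℓ_{m,1} < ℓ_{m,2} < …}` by keeping exactly the `ℓ_{m,n}` (`n ≥ 1`) with `n` not divisible
by `ℓ_{m,m}`. Here `Nat.nth (· ∈ 𝓛ₘ) (n - 1)` is `ℓ_{m,n}`, because `Nat.nth` counts from `0`.
The value at index `0` is irrelevant. -/
noncomputable def luckySieve : ℕ → Set ℕ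
  | 0 => {x | 1 ≤ x}
  | 1 => {x | 1 ≤ x}
  | 2 => {x | x = 2 ∨ (Odd x ∧ 3 ≤ x)}
  | m + 3 =>
    {x | ∃ n : ℕ, 1 ≤ n ∧
      ¬ (Nat.nth (fun y => y ∈ luckySieve (m + 2)) ((m + 2) - 1) ∣ n) ∧
      x = Nat.nth (fun y => y ∈ luckySieve (m + 2)) (n - 1)}

/-- `luckyTerm m n = ℓ_{m,n}` is, for `m, n ≥ 1`, the `n`-th smallest element of `𝓛ₘ`. -/
noncomputable def luckyTerm (m n : ℕ) : ℕ :=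
  Nat.nth (fun y => y ∈ luckySieve m) (n - 1)

/-- `lucky n = ℓₙ` is the `n`-th lucky number for `n ≥ 1`: `ℓₙ = ℓ_{n,n}` for `n ≥ 2`, and `ℓ₁ = 2`
by convention. The value at `0` is irrelevant. -/
noncomputable def lucky (n : ℕ) : ℕ :=
  if n = 1 then 2 else luckyTerm n n

/-!
Ranks are counted from `0`. Undoing the sieving step given by `ℓₘ` moves rank `x` to
`x + ⌊x / (ℓₘ - 1)⌋` (`survivor_succ`), and the step leaves the `n`-th element alone once `ℓₘ > n`.
Hence, with `π(n)` the number of `ℓᵢ ≤ n` and `w(M) = 2 ∏_{2 ≤ i ≤ M} (1 - 1 / ℓᵢ)⁻¹`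
(`sieveProd`), rounding gives
`(n - π(n)) w(π(n)) + 1 ≤ ℓₙ ≤ (n - 1) w(π(n)) + 1`.
It therefore suffices to show `w(M) < B(ℓ_M)`, where `n * B(n)` is the claimed bound: for
`M = π(n)` one has `ℓ_M ≤ n`.

To bound `w`, write `w(m) - w(m - 1) = r(m) / m` with `r(m) = m w(m) / ℓₘ` (`sieveRate`). The lower
bound for `ℓₘ` bounds `r(m)` by roughly `w(m) / w(π(m))`, and the numerator exceeds the denominator
by the sum of `r(j) / j` over `π(m) < j ≤ m`. So a bound for `r` on `[π(m), m)` yields one at `m`;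
the quotient `m / π(m)` that enters is at most `w(π(m))`. This is `sieveRate_le`. It is applied
twice: first the constant bound `r ≤ 1.385` reproduces itself (`sieveRate_le_const`), then the
decreasing bound `r(m) ≤ 1 + (log x + 2) / (x - 8)` with `x = w(m)` does
(`sieveRate_le_rateBound`). Since also `w(m) ≥ log m + 5.38`, summing the second bound gives
`w(m) ≤ t + (log t)² / 2 + 2 log t + O(1)` with `t = log m`, which is good enough because
`log ℓₘ` is about `t + log t`. In the range `ℓₘ ≤ 10 ^ 7` the bound without a `log log` term is
needed, and there the constant rate already suffices.

The induction starts from a computation that the kernel evaluates (`wholeCheck`): the first `3000`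
lucky numbers, which settle the claim for `n ≤ 3000`, and from them, with `ℓₘ` evaluated only at
sample points, bounds for `w` and `r` up to the index `30367 = ℓ₃₀₀₀`.
-/

/-! ### The sieve in terms of ranks -/

/-- A strictly increasing sequence enumerates its range, so it agrees with `Nat.nth`. -/
theorem nth_mem_eq_of_strictMono {g : ℕ → ℕ} {S : Set ℕ} (hg : StrictMono g)
    (hS : Set.range g = S) : Nat.nth (fun y => y ∈ S) = g := by
  have hS' : Set.ofPred (fun y => y ∈ S) = S := rfl
  have hinf : (Set.ofPred fun y => y ∈ S).Infinite := by
    rw [hS', ← hS]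
    exact Set.infinite_range_of_injective hg.injective
  refine (StrictMono.range_inj (Nat.nth_strictMono hinf) hg).1 ?_
  rw [Nat.range_nth_of_infinite hinf, hS, hS']

/-- `survivor m x` is the element of rank `x`, counted from `0`, of the `m`-th sieve set. -/
noncomputable def survivor (m x : ℕ) : ℕ := Nat.nth (fun y => y ∈ luckySieve m) x

theorem luckyTerm_eq_survivor (m n : ℕ) : luckyTerm m n = survivor m (n - 1) := rfl

theorem survivor_two (x : ℕ) : survivor 2 x = if x = 0 then 2 else 2 * x + 1 := by
  have h : Nat.nth (fun y => y ∈ luckySieve 2) = fun x => if x = 0 then 2 else 2 * x + 1 := by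
    refine nth_mem_eq_of_strictMono ?_ ?_
    · refine strictMono_nat_of_lt_succ fun n => ?_
      rw [if_neg (Nat.succ_ne_zero n)]
      split_ifs <;> omega
    · ext y
      simp only [Set.mem_range, luckySieve, Set.mem_ofPred_eq]
      constructor
      · rintro ⟨x, rfl⟩
        split_ifs with hx
        · exact Or.inl rfl
        · exact Or.inr ⟨⟨x, rfl⟩, by omega⟩
      · rintro (rfl | ⟨⟨x, rfl⟩, hx⟩)
        · exact ⟨0, rfl⟩
        · exact ⟨x, by rw [if_neg (by omega)]⟩
  exact congrFun h x

/-- With ranks counted from `0`, deleting every `(d + 1)`-st element of a set moves the element of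
rank `x + x / d` to rank `x`. -/
theorem range_add_div (d : ℕ) (hd : 0 < d) :
    Set.range (fun x : ℕ => x + x / d + 1) = {n | 1 ≤ n ∧ ¬ (d + 1) ∣ n} := by
  ext n
  simp only [Set.mem_range, Set.mem_ofPred_eq]
  constructor
  · rintro ⟨x, rfl⟩
    refine ⟨Nat.succ_pos _, fun ⟨c, hc⟩ => ?_⟩
    have h1 := Nat.div_add_mod x d
    have h2 := Nat.mod_lt x hd
    generalize x / d = q at *
    generalize x % d = r at *
    subst h1
    have h3 : (d + 1) * q + (r + 1) = (d + 1) * c := by rw [← hc]; ring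
    have h4 : q < c := by
      by_contra! h
      have := Nat.mul_le_mul_left (d + 1) h
      omega
    have := Nat.mul_le_mul_left (d + 1) h4
    rw [Nat.succ_eq_add_one, mul_add, mul_one] at this
    omega
  · rintro ⟨h1, h2⟩
    have h3 := Nat.div_add_mod n (d + 1)
    have h4 : n % (d + 1) ≠ 0 := fun h => h2 (Nat.dvd_of_mod_eq_zero h)
    have h5 := Nat.mod_lt n (Nat.succ_pos d)
    generalize n / (d + 1) = q at *
    generalize n % (d + 1) = r at *
    refine ⟨d * q + (r - 1), ?_⟩
    have h6 : (d * q + (r - 1)) / d = q := by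
      rw [Nat.mul_add_div hd, Nat.div_eq_of_lt (by omega), add_zero]
    simp only [h6]
    rw [← h3]
    have : (d + 1) * q = d * q + q := by ring
    omega

/-- Monotonicity of the enumeration and the effect of one sieving step have to be proved together:
the range computation for the next set needs that `survivor (m + 2)` is increasing, and the step
then shows the same for `survivor (m + 3)`. -/
theorem survivor_step_aux (m : ℕ) : StrictMono (survivor (m + 2)) ∧ ∀ x,
    survivor (m + 3) x = survivor (m + 2) (x + x / (survivor (m + 2) (m + 1) - 1)) := by
  have step : ∀ m, StrictMono (survivor (m + 2)) → 2 ≤ survivor (m + 2) 0 →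
      survivor (m + 3) =
        fun x => survivor (m + 2) (x + x / (survivor (m + 2) (m + 1) - 1)) := by
    intro m hm h0
    have hd : 2 < survivor (m + 2) (m + 1) := lt_of_le_of_lt h0 (hm (Nat.succ_pos m))
    refine nth_mem_eq_of_strictMono (hm.comp ?_) ?_
    · refine strictMono_nat_of_lt_succ fun n => ?_
      have := Nat.div_le_div_right (c := survivor (m + 2) (m + 1) - 1) (Nat.le_succ n)
      simp only [Nat.succ_eq_add_one] at this
      omega
    · have hr := range_add_div (survivor (m + 2) (m + 1) - 1) (by omega)
      rw [Nat.sub_add_cancel (by omega)] at hr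
      ext y
      simp only [Set.mem_range, luckySieve, Set.mem_ofPred_eq]
      constructor
      · rintro ⟨x, rfl⟩
        have hx : x + x / (survivor (m + 2) (m + 1) - 1) + 1 ∈
            {n | 1 ≤ n ∧ ¬ survivor (m + 2) (m + 1) ∣ n} := hr ▸ ⟨x, rfl⟩
        exact ⟨_, hx.1, hx.2, rfl⟩
      · rintro ⟨n, h1, h2, rfl⟩
        have hn : n ∈ {n | 1 ≤ n ∧ ¬ survivor (m + 2) (m + 1) ∣ n} := ⟨h1, h2⟩
        rw [← hr] at hn
        obtain ⟨x, rfl⟩ := hn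
        exact ⟨x, rfl⟩
  have key : ∀ m, StrictMono (survivor (m + 2)) ∧ 2 ≤ survivor (m + 2) 0 := by
    intro m
    induction m with
    | zero =>
      refine ⟨strictMono_nat_of_lt_succ fun n => ?_, ?_⟩
      · simp only [zero_add, survivor_two]
        rw [if_neg (Nat.succ_ne_zero n)]
        split_ifs <;> omega
      · simp [survivor_two]
    | succ m ih =>
      have h := step m ih.1 ih.2
      refine ⟨?_, ?_⟩
      · rw [show m + 1 + 2 = m + 3 from rfl, h]
        refine ih.1.comp (strictMono_nat_of_lt_succ fun n => ?_)
        have := Nat.div_le_div_right (c := survivor (m + 2) (m + 1) - 1) (Nat.le_succ n)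
        simp only [Nat.succ_eq_add_one] at this
        omega
      · rw [show m + 1 + 2 = m + 3 from rfl, h]
        simpa using ih.2
  exact ⟨(key m).1, fun x => congrFun (step m (key m).1 (key m).2) x⟩

theorem survivor_strictMono {m : ℕ} (hm : 2 ≤ m) : StrictMono (survivor m) := by
  obtain ⟨k, rfl⟩ := Nat.exists_eq_add_of_le' hm
  exact (survivor_step_aux k).1

theorem lucky_eq_survivor {n : ℕ} (hn : 2 ≤ n) : lucky n = survivor n (n - 1) := by
  rw [lucky, if_neg (by omega), luckyTerm_eq_survivor]

/-- The sieving step in rank form: the survivor of rank `x` after the step given by `ℓₘ` had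
rank `x + ⌊x / (ℓₘ - 1)⌋` before it. -/
theorem survivor_succ {m : ℕ} (hm : 2 ≤ m) (x : ℕ) :
    survivor (m + 1) x = survivor m (x + x / (lucky m - 1)) := by
  obtain ⟨k, rfl⟩ := Nat.exists_eq_add_of_le' hm
  rw [lucky_eq_survivor (by omega)]
  exact (survivor_step_aux k).2 x

theorem lucky_two : lucky 2 = 3 := by
  rw [lucky_eq_survivor le_rfl, survivor_two]
  rfl

theorem lucky_lt_succ {m : ℕ} (hm : 2 ≤ m) : lucky m < lucky (m + 1) := by
  rw [lucky_eq_survivor hm, lucky_eq_survivor (by omega), survivor_succ hm]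
  refine survivor_strictMono hm ?_
  generalize (m + 1 - 1) / (lucky m - 1) = q
  omega

theorem lucky_strictMonoOn {m n : ℕ} (hm : 2 ≤ m) (hmn : m < n) : lucky m < lucky n := by
  induction n, hmn using Nat.le_induction with
  | base => exact lucky_lt_succ hm
  | succ n hn ih => exact ih.trans (lucky_lt_succ (by omega))

theorem lucky_mono {m n : ℕ} (hm : 2 ≤ m) (hmn : m ≤ n) : lucky m ≤ lucky n := by
  rcases hmn.eq_or_lt with rfl | h
  · exact le_rfl
  · exact (lucky_strictMonoOn hm h).le

theorem lt_lucky {m : ℕ} (hm : 2 ≤ m) : m < lucky m := by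
  induction m, hm using Nat.le_induction with
  | base => simp [lucky_two]
  | succ n hn ih => have := lucky_lt_succ hn; omega

/-- Once `ℓₘ > n`, the sieving steps leave the `n`-th element unchanged. -/
theorem lucky_eq_survivor_of_lt {M n : ℕ} (hM : 1 ≤ M) (hMn : M < n) (h : n < lucky (M + 1)) :
    lucky n = survivor (M + 1) (n - 1) := by
  have key : ∀ m, M + 1 ≤ m → survivor m (n - 1) = survivor (M + 1) (n - 1) := by
    intro m hm
    induction m, hm using Nat.le_induction with
    | base => rfl
    | succ m hm ih =>
      have h1 := lucky_mono (m := M + 1) (by omega) hm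
      rw [survivor_succ (by omega), Nat.div_eq_of_lt (by omega), add_zero, ih]
  rw [lucky_eq_survivor (by omega), key n hMn]

/-- For `n ≥ 3` the number `M` of indices `i` with `ℓᵢ ≤ n` satisfies `2 ≤ M < n`. It is handled
through the two inequalities `ℓ_M ≤ n < ℓ_{M+1}` that determine it. -/
theorem exists_lucky_le_lt {n : ℕ} (hn : 3 ≤ n) :
    ∃ M, 2 ≤ M ∧ M < n ∧ lucky M ≤ n ∧ n < lucky (M + 1) := by
  have hex : ∃ m, n < lucky (m + 3) := ⟨n, by have := lt_lucky (m := n + 3) (by omega); omega⟩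
  classical
  obtain ⟨k, h1, h2⟩ : ∃ k, n < lucky (k + 3) ∧ ∀ j < k, ¬ n < lucky (j + 3) :=
    ⟨Nat.find hex, Nat.find_spec hex, fun j hj => Nat.find_min hex hj⟩
  have h3 : lucky (k + 2) ≤ n := by
    rcases k with _ | k
    · simpa [lucky_two] using hn
    · exact not_lt.1 (h2 k (Nat.lt_succ_self k))
  exact ⟨k + 2, by omega, (lt_lucky (by omega)).trans_le h3, h3, h1⟩

/-! ### The sieve product and its growth rate -/

/-- The product `2 ∏_{2 ≤ i ≤ M} (1 - 1 / ℓᵢ)⁻¹`. Up to rounding it is the factor by which the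
sieving steps `2, …, M` stretch a long initial segment of the positive integers. -/
noncomputable def sieveProd (M : ℕ) : ℝ :=
  2 * ∏ i ∈ Finset.Icc 2 M, (lucky i : ℝ) / ((lucky i : ℝ) - 1)

/-- The growth rate of `sieveProd` at `j` on a logarithmic scale:
`sieveProd j - sieveProd (j - 1) = sieveRate j / j`. -/
noncomputable def sieveRate (j : ℕ) : ℝ := j * sieveProd j / lucky j

theorem three_le_lucky {m : ℕ} (hm : 2 ≤ m) : 3 ≤ lucky m :=
  lucky_two ▸ lucky_mono le_rfl hm

theorem three_le_lucky_cast {m : ℕ} (hm : 2 ≤ m) : (3 : ℝ) ≤ lucky m := by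
  exact_mod_cast three_le_lucky hm

theorem sieveProd_one : sieveProd 1 = 2 := by simp [sieveProd]

theorem sieveProd_succ {M : ℕ} (hM : 1 ≤ M) :
    sieveProd (M + 1) = sieveProd M * ((lucky (M + 1) : ℝ) / ((lucky (M + 1) : ℝ) - 1)) := by
  rw [sieveProd, Finset.prod_Icc_succ_top (by omega), sieveProd, mul_assoc]

theorem two_le_sieveProd (M : ℕ) : 2 ≤ sieveProd M := by
  have : 1 ≤ ∏ i ∈ Finset.Icc 2 M, (lucky i : ℝ) / ((lucky i : ℝ) - 1) := by
    refine Finset.prod_induction _ (1 ≤ ·) (fun _ _ => one_le_mul_of_one_le_of_one_le) le_rfl ?_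
    intro i hi
    have := three_le_lucky_cast (Finset.mem_Icc.1 hi).1
    rw [le_div_iff₀ (by linarith)]
    linarith
  rw [sieveProd]
  linarith

theorem sieveProd_pos (M : ℕ) : 0 < sieveProd M := two_pos.trans_le (two_le_sieveProd M)

theorem sieveProd_succ_sub {M : ℕ} (hM : 1 ≤ M) :
    sieveProd (M + 1) - sieveProd M = sieveProd M / ((lucky (M + 1) : ℝ) - 1) := by
  have h := three_le_lucky_cast (m := M + 1) (by omega)
  have h1 : (lucky (M + 1) : ℝ) - 1 ≠ 0 := by linarith
  rw [sieveProd_succ hM]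
  field_simp
  ring

theorem sieveRate_succ {M : ℕ} (hM : 1 ≤ M) :
    sieveRate (M + 1) = (M + 1) * (sieveProd M / ((lucky (M + 1) : ℝ) - 1)) := by
  have h := three_le_lucky_cast (m := M + 1) (by omega)
  have h1 : (lucky (M + 1) : ℝ) - 1 ≠ 0 := by linarith
  have h2 : (lucky (M + 1) : ℝ) ≠ 0 := by linarith
  rw [sieveRate, sieveProd_succ hM]
  push_cast
  field_simp

theorem sieveProd_succ_eq_add {M : ℕ} (hM : 1 ≤ M) :
    sieveProd (M + 1) = sieveProd M + sieveRate (M + 1) / (M + 1) := by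
  have h := sieveProd_succ_sub hM
  have h' : (M : ℝ) + 1 ≠ 0 := by positivity
  rw [sieveRate_succ hM, mul_div_cancel_left₀ _ h']
  linarith

theorem sieveProd_mono {a b : ℕ} (ha : 1 ≤ a) (hab : a ≤ b) : sieveProd a ≤ sieveProd b := by
  induction b, hab using Nat.le_induction with
  | base => exact le_rfl
  | succ n hn ih =>
    have h1 := sieveProd_succ_sub (M := n) (by omega)
    have h2 := three_le_lucky_cast (m := n + 1) (by omega)
    have h3 : 0 ≤ sieveProd n / ((lucky (n + 1) : ℝ) - 1) :=
      div_nonneg (sieveProd_pos n).le (by linarith)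
    linarith

/-- Dropping the rounding in `x + ⌊x / (ℓ - 1)⌋` at each step gives an upper bound. -/
theorem survivor_le {M : ℕ} (hM : 1 ≤ M) {x : ℕ} (hx : 1 ≤ x) :
    (survivor (M + 1) x : ℝ) ≤ x * sieveProd M + 1 := by
  induction M, hM using Nat.le_induction generalizing x with
  | base =>
    rw [survivor_two, if_neg (by omega), sieveProd_one]
    push_cast
    linarith
  | succ M hM ih =>
    have h3 := three_le_lucky (m := M + 1) (by omega)
    have h3' := three_le_lucky_cast (m := M + 1) (by omega)
    rw [survivor_succ (by omega)]
    refine (ih (hx.trans (Nat.le_add_right _ _))).trans ?_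
    have hdiv : ((x / (lucky (M + 1) - 1) : ℕ) : ℝ) ≤ x / ((lucky (M + 1) : ℝ) - 1) := by
      refine Nat.cast_div_le.trans (le_of_eq ?_)
      rw [Nat.cast_sub (by omega), Nat.cast_one]
    have h4 : ((x + x / (lucky (M + 1) - 1) : ℕ) : ℝ) ≤
        x * ((lucky (M + 1) : ℝ) / ((lucky (M + 1) : ℝ) - 1)) := by
      rw [Nat.cast_add]
      refine (add_le_add_right hdiv _).trans (le_of_eq ?_)
      have : (lucky (M + 1) : ℝ) - 1 ≠ 0 := by linarith
      field_simp
      ring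
    rw [sieveProd_succ hM]
    have := mul_le_mul_of_nonneg_right h4 (sieveProd_pos M).le
    linarith

/-- Each of the steps `2, …, M` loses at most one unit of rank to rounding, which is why `M - 1`
is subtracted from the rank. -/
theorem le_survivor {M : ℕ} (hM : 1 ≤ M) {x : ℕ} (hx : 1 ≤ x) :
    (x + 2 - M) * sieveProd M - 1 ≤ (survivor (M + 1) x : ℝ) := by
  induction M, hM using Nat.le_induction generalizing x with
  | base =>
    rw [survivor_two, if_neg (by omega), sieveProd_one]
    push_cast
    linarith
  | succ M hM ih =>
    have h3 := three_le_lucky (m := M + 1) (by omega)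
    have h3' := three_le_lucky_cast (m := M + 1) (by omega)
    rw [survivor_succ (by omega)]
    refine le_trans ?_ (ih (hx.trans (Nat.le_add_right _ _)))
    have hpos : (0 : ℝ) < (lucky (M + 1) : ℝ) - 1 := by linarith
    have hdiv : (x : ℝ) / ((lucky (M + 1) : ℝ) - 1) + 1 / ((lucky (M + 1) : ℝ) - 1) - 1 ≤
        ((x / (lucky (M + 1) - 1) : ℕ) : ℝ) := by
      have h5 : x + 1 ≤ (lucky (M + 1) - 1) * (x / (lucky (M + 1) - 1)) + (lucky (M + 1) - 1) := by
        have h6 := Nat.div_add_mod x (lucky (M + 1) - 1)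
        have h7 := Nat.mod_lt x (show 0 < lucky (M + 1) - 1 by omega)
        omega
      have h8 : (x : ℝ) + 1 ≤ ((lucky (M + 1) : ℝ) - 1) * ((x / (lucky (M + 1) - 1) : ℕ) : ℝ)
          + ((lucky (M + 1) : ℝ) - 1) := by
        have : ((lucky (M + 1) - 1 : ℕ) : ℝ) = (lucky (M + 1) : ℝ) - 1 := by
          rw [Nat.cast_sub (by omega), Nat.cast_one]
        rw [← this]
        exact_mod_cast h5
      rw [← add_div, sub_le_iff_le_add, div_le_iff₀ hpos]
      linarith
    have h4 : ((x : ℝ) + 2 - (M + 1)) * ((lucky (M + 1) : ℝ) / ((lucky (M + 1) : ℝ) - 1)) ≤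
        ((x + x / (lucky (M + 1) - 1) : ℕ) : ℝ) + 2 - M := by
      have hM' : (1 : ℝ) ≤ M := by exact_mod_cast hM
      have e : (lucky (M + 1) : ℝ) / ((lucky (M + 1) : ℝ) - 1) =
          1 + 1 / ((lucky (M + 1) : ℝ) - 1) := by
        field_simp
        ring
      have h9 : 0 ≤ ((M : ℝ)) * (1 / ((lucky (M + 1) : ℝ) - 1)) := by positivity
      have h10 : (x : ℝ) / ((lucky (M + 1) : ℝ) - 1) = x * (1 / ((lucky (M + 1) : ℝ) - 1)) := by
        ring
      rw [Nat.cast_add, e]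
      rw [h10] at hdiv
      nlinarith
    rw [sieveProd_succ hM]
    have := mul_le_mul_of_nonneg_right h4 (sieveProd_pos M).le
    push_cast at this ⊢
    linarith

theorem lucky_le_mul_sieveProd {a n : ℕ} (ha : 1 ≤ a) (han : a < n) (h : n < lucky (a + 1)) :
    (lucky n : ℝ) ≤ (n - 1) * sieveProd a + 1 := by
  have := survivor_le ha (x := n - 1) (by omega)
  rwa [← lucky_eq_survivor_of_lt ha han h, Nat.cast_sub (by omega), Nat.cast_one] at this

theorem mul_sieveProd_le_lucky {a n : ℕ} (ha : 1 ≤ a) (han : a < n) (h : n < lucky (a + 1)) :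
    (n - a) * sieveProd a ≤ (lucky n : ℝ) - 1 := by
  have h1 := le_survivor ha (x := n - 1) (by omega)
  rw [← lucky_eq_survivor_of_lt ha han h, Nat.cast_sub (by omega), Nat.cast_one] at h1
  have := two_le_sieveProd a
  linarith

theorem lucky_sub_one_le {n : ℕ} (hn : 2 ≤ n) : (lucky (n + 1) : ℝ) - 1 ≤ n * sieveProd n := by
  obtain ⟨a, ha, han, -, h⟩ := exists_lucky_le_lt (n := n + 1) (by omega)
  have h1 := lucky_le_mul_sieveProd (by omega) han h
  have h2 := sieveProd_mono (by omega) (Nat.lt_succ_iff.1 han)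
  have h3 : (n : ℝ) * sieveProd a ≤ n * sieveProd n := by gcongr
  push_cast at h1
  linarith

/-- `sieveProd` grows at least like the logarithm, because `ℓₙ` is at most `n` times
`sieveProd n`. -/
theorem sieveProd_add_log_le {a m : ℕ} (ha : 2 ≤ a) (ham : a ≤ m) :
    sieveProd a + (Real.log m - Real.log a) ≤ sieveProd m := by
  induction m, ham using Nat.le_induction with
  | base => simp
  | succ m hm ih =>
    have hm0 : (0 : ℝ) < m := by exact_mod_cast (by omega : 0 < m)
    have h1 := sieveProd_succ_sub (M := m) (by omega)
    have h2 := lucky_sub_one_le (n := m) (by omega)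
    have h3 := three_le_lucky_cast (m := m + 1) (by omega)
    have h4 : 1 / (m : ℝ) ≤ sieveProd m / ((lucky (m + 1) : ℝ) - 1) := by
      rw [div_le_div_iff₀ hm0 (by linarith)]
      linarith
    have h5 : Real.log ((m + 1 : ℕ) : ℝ) - Real.log m ≤ 1 / m := by
      rw [← Real.log_div (by positivity) hm0.ne']
      refine (Real.log_le_sub_one_of_pos (by positivity)).trans (le_of_eq ?_)
      push_cast
      field_simp
      ring
    linarith

/-- If the growth rate is at most `Q` on `(a, m]`, then `sieveProd` grows by at most `Q log (m / a)`. -/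
theorem sieveProd_le_add_log {a m : ℕ} (ha : 1 ≤ a) (ham : a ≤ m) {Q : ℝ} (hQ : 0 ≤ Q)
    (h : ∀ j, a < j → j ≤ m → sieveRate j ≤ Q) :
    sieveProd m ≤ sieveProd a + Q * (Real.log m - Real.log a) := by
  induction m, ham using Nat.le_induction with
  | base => simp
  | succ m hm ih =>
    have ih := ih fun j h1 h2 => h j h1 (by omega)
    have hm0 : (0 : ℝ) < m := by exact_mod_cast (by omega : 0 < m)
    have h1 := sieveProd_succ_eq_add (M := m) (by omega)
    have h2 : sieveRate (m + 1) / (m + 1) ≤ Q / (m + 1) := by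
      gcongr
      exact h _ (by omega) le_rfl
    have h5 : 1 / ((m : ℝ) + 1) ≤ Real.log ((m + 1 : ℕ) : ℝ) - Real.log m := by
      rw [← Real.log_div (by positivity) hm0.ne']
      refine le_trans (le_of_eq ?_) (Real.one_sub_inv_le_log_of_pos (by positivity))
      push_cast
      field_simp
      ring
    have h6 := mul_le_mul_of_nonneg_left h5 hQ
    rw [mul_one_div] at h6
    linarith

/-- The recursion for the growth rate. Let `a` be the number of `ℓᵢ ≤ m`, put `p = m / a` and
`u = sieveProd a`. Then `ℓₘ ≥ (m - a) u`, so the rate at `m` is at most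
`p / (p - 1) * (1 + Q * log p / u)`; the bound stated here is independent of `p`, which lies
between `u / Q` and `u`. -/
theorem sieveRate_le {a m : ℕ} {Q : ℝ} (ha : 2 ≤ a) (ham : a < m) (h1 : lucky a ≤ m)
    (h2 : m < lucky (a + 1)) (hQ : 1 ≤ Q) (hQu : Q < sieveProd a)
    (h : ∀ j, a ≤ j → j < m → sieveRate j ≤ Q) :
    sieveRate m ≤ 1 + (1 + Q * Real.log (sieveProd a)) / (sieveProd a - Q) := by
  set u := sieveProd a with hu
  have ha0 : (0 : ℝ) < a := by exact_mod_cast (by omega : 0 < a)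
  have hu0 : 0 < u := by linarith
  obtain ⟨n, rfl⟩ : ∃ n, m = n + 1 := ⟨m - 1, by omega⟩
  have hna : (0 : ℝ) < (n : ℝ) + 1 - a := by
    have : (a : ℝ) < ((n + 1 : ℕ) : ℝ) := by exact_mod_cast ham
    push_cast at this
    linarith
  obtain ⟨p, hp⟩ : ∃ p : ℝ, p = ((n : ℝ) + 1) / a := ⟨_, rfl⟩
  have hpa : p * a = (n : ℝ) + 1 := by rw [hp]; field_simp
  have hp1 : 1 < p := by
    rw [hp, lt_div_iff₀ ha0]
    linarith
  have hlow : u ≤ p * Q := by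
    have hr := h a le_rfl ham
    have hl := three_le_lucky_cast ha
    rw [sieveRate, div_le_iff₀ (by linarith)] at hr
    have hl2 : (lucky a : ℝ) ≤ (n : ℝ) + 1 := by exact_mod_cast h1
    have h3 : a * u ≤ Q * ((n : ℝ) + 1) := hr.trans (by gcongr)
    rw [← hpa] at h3
    have h4 : a * u ≤ a * (p * Q) := by linarith
    exact le_of_mul_le_mul_left h4 ha0
  have hup : p ≤ u := by
    have h3 := lucky_sub_one_le ha
    have h4 : (n : ℝ) + 1 + 1 ≤ lucky (a + 1) := by exact_mod_cast h2
    rw [hp, div_le_iff₀ ha0]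
    linarith
  have hrate : sieveRate (n + 1) ≤ p * (u + Q * Real.log p) / ((p - 1) * u) := by
    have h3 := mul_sieveProd_le_lucky (by omega) ham h2
    rw [← hu] at h3
    push_cast at h3
    have h4 : sieveProd n ≤ u + Q * Real.log p := by
      refine (sieveProd_le_add_log (by omega) (Nat.lt_succ_iff.1 ham) (by linarith)
        fun j hj1 hj2 => h j hj1.le (by omega)).trans ?_
      have hn0 : (0 : ℝ) < n := by exact_mod_cast (by omega : 0 < n)
      rw [hp, Real.log_div (by positivity) ha0.ne']
      gcongr
      linarith
    have h5 : (p - 1) * u * a = ((n : ℝ) + 1 - a) * u := by rw [← hpa]; ring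
    rw [sieveRate_succ (by omega), le_div_iff₀ (by nlinarith)]
    have h6 : 0 < ((n : ℝ) + 1 - a) * u := by positivity
    calc ((n : ℝ) + 1) * (sieveProd n / ((lucky (n + 1) : ℝ) - 1)) * ((p - 1) * u)
        ≤ ((n : ℝ) + 1) * (sieveProd n / (((n : ℝ) + 1 - a) * u)) * ((p - 1) * u) := by
          have := (sieveProd_pos n).le
          have : 0 ≤ p - 1 := by linarith
          gcongr
      _ = p * sieveProd n := by
          rw [← h5, ← hpa]
          have : p - 1 ≠ 0 := by linarith
          field_simp
      _ ≤ p * (u + Q * Real.log p) := by gcongr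
  -- on `1 ≤ u / p ≤ Q` one has `u / p - 1 ≤ Q * log (u / p)`
  have hE : u / p + Q * Real.log p ≤ 1 + Q * Real.log u := by
    have h3 : 1 - (u / p)⁻¹ ≤ Real.log (u / p) := Real.one_sub_inv_le_log_of_pos (by positivity)
    rw [Real.log_div hu0.ne' (by linarith), inv_div] at h3
    have h4 : u / p - 1 ≤ Q * (1 - p / u) := by
      have h5 : u / p - 1 = (u - p) / p := by field_simp
      have h6 : Q * (1 - p / u) = Q * (u - p) / u := by field_simp
      rw [h5, h6, div_le_div_iff₀ (by linarith) hu0]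
      have : 0 ≤ (u - p) * (p * Q - u) := mul_nonneg (by linarith) (by linarith)
      linarith
    have h7 := mul_le_mul_of_nonneg_left h3 (show 0 ≤ Q by linarith)
    linarith
  have hlogu : 0 ≤ Real.log u := Real.log_nonneg (by linarith)
  have hp1' : 0 < p - 1 := by linarith
  have hp0 : 0 < p := by linarith
  have huQ : 0 < u - Q := by linarith
  refine hrate.trans ?_
  have e1 : p * (u + Q * Real.log p) / ((p - 1) * u) =
      1 + p / ((p - 1) * u) * (u / p + Q * Real.log p) := by
    field_simp
    ring
  have e2 : p / ((p - 1) * u) ≤ 1 / (u - Q) := by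
    rw [div_le_div_iff₀ (by positivity) huQ]
    nlinarith
  rw [e1]
  have h8 : 0 ≤ 1 + Q * Real.log u := by
    have : 0 ≤ Q * Real.log u := mul_nonneg (by linarith) hlogu
    linarith
  calc 1 + p / ((p - 1) * u) * (u / p + Q * Real.log p)
      ≤ 1 + p / ((p - 1) * u) * (1 + Q * Real.log u) := by gcongr
    _ ≤ 1 + 1 / (u - Q) * (1 + Q * Real.log u) := by gcongr
    _ = _ := by ring

/-! ### The computation -/

/-- The value `f v`, written as a recursion on `v` that does not use the induction hypothesis. Kernel
evaluation is lazy; a recursion reduces its major premise to a numeral first, so `f` receives an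
evaluated argument instead of a growing unevaluated term. -/
def forceNat {α : Type} (v : ℕ) (f : ℕ → α) : α :=
  Nat.rec (motive := fun _ => α) (f 0) (fun k _ => f (Nat.succ k)) v

/-- Undoing sieving steps: `x ↦ x + ⌊x / d⌋` for the elements `d` of the list, the first one first.
The recursor is used directly to keep kernel evaluation cheap. -/
def unsieve (R : List ℕ) (x : ℕ) : ℕ :=
  List.rec (motive := fun _ => ℕ → ℕ) (fun x => x)
    (fun d _ ih x => forceNat (Nat.add x (Nat.div x d)) ih) R x

/-- A lower bound in units of `10⁻⁶` for `log (x / 10⁶)`, from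
`log (x / 10⁶) = k log 2 + log ((1 + y) / (1 - y))` and `log ((1 + y) / (1 - y)) ≥ 2 y + 2 y³ / 3`.
It is meaningful only for `x ≥ 10⁶`. -/
def logLower (x : ℕ) : ℕ :=
  forceNat (Nat.log2 (x / 1000000)) fun k =>
  forceNat (1000000 * Nat.pow 2 k) fun c =>
  forceNat (1000000 * (x - c) / (x + c)) fun y =>
  k * 693147 + 2 * y + 2 * (y * y * y) / 3000000000000

/-- A lower bound in units of `10⁻⁶` for `log n + (log log n)² / 2 + 1`. -/
def boundLower (n : ℕ) : ℕ :=
  forceNat (logLower (n * 1000000)) fun a =>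
  forceNat (logLower a) fun b =>
  a + b * b / 2000000 + 1000000

/-- With `ℓₙ = d + 1` and `hi ≥ 10⁹ sieveProd n`: the claim for `ℓₙ` holds, and for `n ≥ 21` also
`sieveProd n < log ℓₙ + (log log ℓₙ)² / 2 + 1`. -/
def stepCheck (n d hi : ℕ) : Bool :=
  Nat.blt ((d + 1) * 1000000) (n * boundLower n) &&
    (Nat.ble n 20 || Nat.blt hi (1000 * boundLower (d + 1)))

/-- Starting from the list `S` of the `ℓᵢ - 1` for `2 ≤ i ≤ B` and from bounds `lo`, `hi` for
`10⁹ sieveProd B`, computes and checks the next `c` lucky numbers and passes the new list and bounds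
to `k`. The list `R` of the `ℓᵢ - 1` for `2 ≤ i ≤ A` is the one used to undo the sieve; it need only
reach the lucky numbers up to `B + c`. -/
def extendLoop (R : List ℕ) (c : ℕ) :
    ℕ → List ℕ → ℕ → ℕ → (List ℕ → ℕ → ℕ → Bool) → Bool :=
  Nat.rec (motive := fun _ => ℕ → List ℕ → ℕ → ℕ → (List ℕ → ℕ → ℕ → Bool) → Bool)
    (fun _ S lo hi k => k S lo hi)
    (fun _ ih B S lo hi k =>
      forceNat (2 * unsieve R B) fun d =>
      forceNat (lo * (d + 1) / d) fun lo' =>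
      forceNat (hi * (d + 1) / d + 1) fun hi' =>
      forceNat (B + 1) fun n =>
      stepCheck n d hi' && ih n (d :: S) lo' hi' k) c

/-- `extendLoop` with `R = S`, after checking `B + c ≤ ℓ_B`. -/
def extend (B c : ℕ) (S : List ℕ) (lo hi : ℕ) (k : List ℕ → ℕ → ℕ → Bool) : Bool :=
  List.rec (motive := fun _ => Bool) false
    (fun d _ _ => Nat.ble (B + c) (d + 1) && extendLoop S c B S lo hi k) S

/-- From `hi ≥ 10⁹ sieveProd m`, passes `c` times to the index `m' = min (m + ⌊m / 64⌋) N`: on the block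
`(m, m']` all `ℓᵢ` are at least `l = ℓₘ`, hence `sieveProd` grows at most by the factor
`l / (l - (m' - m))`. Checks the bounds for the growth rate and for `sieveProd` on each block. -/
def sampleLoop (R : List ℕ) (N c : ℕ) : ℕ → ℕ → (ℕ → ℕ → Bool) → Bool :=
  Nat.rec (motive := fun _ => ℕ → ℕ → (ℕ → ℕ → Bool) → Bool)
    (fun m hi k => k m hi)
    (fun _ ih m hi k =>
      forceNat (2 * unsieve R (m - 1) + 1) fun l =>
      forceNat (min (m + m / 64) N) fun m' =>
      forceNat (hi * l / (l - (m' - m)) + 1) fun hi' =>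
      (Nat.ble (m' * hi') (1385000000 * l) && Nat.blt hi' (1000 * boundLower l)) &&
        ih m' hi' k) c

/-- The check of the data at the index `3000`, where `ℓ₃₀₀₀ = 30367`, followed by blocks up to the
index `30367`. -/
def finalCheck (S : List ℕ) (lo hi : ℕ) : Bool :=
  (Nat.ble 13390000000 lo && Nat.ble (3000 * hi) (1385000000 * 30367)) &&
  ((List.rec (motive := fun _ => Bool) false (fun d _ _ => Nat.beq d 30366) S) &&
  sampleLoop S 30367 150 3000 hi fun m h => Nat.beq m 30367 && Nat.ble h 16440000000)

/-- The verification up to the index `3000` in five rounds, starting from `ℓ₂ = 3`, `ℓ₃ = 7` and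
`sieveProd 3 = 7 / 2`, followed by `finalCheck`. A list of the first `B` lucky numbers suffices for
the indices up to `ℓ_B`, which is why each round can reach so much further than the preceding one. -/
def wholeCheck : Bool :=
  extend 3 4 [6, 2] 3500000000 3500000000 fun S lo hi =>
  extend 7 14 S lo hi fun S lo hi =>
  extend 21 66 S lo hi fun S lo hi =>
  extend 87 313 S lo hi fun S lo hi =>
  extend 400 2600 S lo hi finalCheck


theorem forceNat_eq {α : Type} (v : ℕ) (f : ℕ → α) : forceNat v f = f v := by
  cases v <;> rfl

theorem unsieve_nil (x : ℕ) : unsieve [] x = x := rfl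

theorem unsieve_cons (d : ℕ) (R : List ℕ) (x : ℕ) :
    unsieve (d :: R) x = unsieve R (x + x / d) :=
  forceNat_eq (Nat.add x (Nat.div x d)) (unsieve R)

theorem extendLoop_succ (R : List ℕ) (c B : ℕ) (S : List ℕ) (lo hi : ℕ)
    (k : List ℕ → ℕ → ℕ → Bool) :
    extendLoop R (c + 1) B S lo hi k =
      (stepCheck (B + 1) (2 * unsieve R B) (hi * (2 * unsieve R B + 1) / (2 * unsieve R B) + 1) &&
        extendLoop R c (B + 1) (2 * unsieve R B :: S)
          (lo * (2 * unsieve R B + 1) / (2 * unsieve R B))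
          (hi * (2 * unsieve R B + 1) / (2 * unsieve R B) + 1) k) := by
  have h : extendLoop R (c + 1) B S lo hi k = forceNat (2 * unsieve R B) fun d =>
      forceNat (lo * (d + 1) / d) fun lo' => forceNat (hi * (d + 1) / d + 1) fun hi' =>
      forceNat (B + 1) fun n => stepCheck n d hi' && extendLoop R c n (d :: S) lo' hi' k := rfl
  rw [h]
  simp only [forceNat_eq]

theorem sampleLoop_succ (R : List ℕ) (N c m hi : ℕ) (k : ℕ → ℕ → Bool) {l m' hi' : ℕ}
    (hl : l = 2 * unsieve R (m - 1) + 1) (hm : m' = min (m + m / 64) N)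
    (hhi : hi' = hi * l / (l - (m' - m)) + 1) :
    sampleLoop R N (c + 1) m hi k =
      ((Nat.ble (m' * hi') (1385000000 * l) && Nat.blt hi' (1000 * boundLower l)) &&
        sampleLoop R N c m' hi' k) := by
  have h : sampleLoop R N (c + 1) m hi k = forceNat (2 * unsieve R (m - 1) + 1) fun l =>
      forceNat (min (m + m / 64) N) fun m' => forceNat (hi * l / (l - (m' - m)) + 1) fun hi' =>
      (Nat.ble (m' * hi') (1385000000 * l) && Nat.blt hi' (1000 * boundLower l)) &&
        sampleLoop R N c m' hi' k := rfl
  rw [h]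
  simp only [forceNat_eq, hhi, hl, hm]

theorem logLower_eq (x : ℕ) : logLower x =
    Nat.log2 (x / 1000000) * 693147 +
      2 * (1000000 * (x - 1000000 * 2 ^ Nat.log2 (x / 1000000)) /
        (x + 1000000 * 2 ^ Nat.log2 (x / 1000000))) +
      2 * (1000000 * (x - 1000000 * 2 ^ Nat.log2 (x / 1000000)) /
        (x + 1000000 * 2 ^ Nat.log2 (x / 1000000))) ^ 3 / 3000000000000 := by
  simp only [logLower, forceNat_eq, pow_three']
  rfl

theorem boundLower_eq (n : ℕ) : boundLower n =
    logLower (n * 1000000) + logLower (logLower (n * 1000000)) ^ 2 / 2000000 + 1000000 := by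
  simp only [boundLower, forceNat_eq, sq]

theorem two_mul_add_cube_le_log {y : ℝ} (h0 : 0 ≤ y) (h1 : y < 1) :
    2 * y + 2 * y ^ 3 / 3 ≤ Real.log ((1 + y) / (1 - y)) := by
  have h := Real.sum_range_le_log_div h0 h1 2
  simp only [Finset.sum_range_succ, Finset.sum_range_zero] at h
  norm_num at h
  linarith

theorem logLower_le {x : ℕ} (hx : 1000000 ≤ x) :
    (logLower x : ℝ) ≤ 1000000 * Real.log (x / 1000000) := by
  rw [logLower_eq]
  have hk : 1000000 * 2 ^ Nat.log2 (x / 1000000) ≤ x := by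
    have h1 := Nat.log2_self_le (n := x / 1000000) (by omega)
    have h2 := Nat.mul_div_le x 1000000
    omega
  generalize Nat.log2 (x / 1000000) = k at *
  obtain ⟨c, hc⟩ : ∃ c, c = 1000000 * 2 ^ k := ⟨_, rfl⟩
  rw [← hc] at hk ⊢
  have hc0 : 0 < c := by rw [hc]; positivity
  obtain ⟨y, hy⟩ : ∃ y, y = 1000000 * (x - c) / (x + c) := ⟨_, rfl⟩
  rw [← hy]
  have hc0' : (0 : ℝ) < c := by exact_mod_cast hc0
  have hk' : (c : ℝ) ≤ x := by exact_mod_cast hk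
  have hcR : (c : ℝ) = 1000000 * 2 ^ k := by rw [hc]; push_cast; rfl
  obtain ⟨z, hz⟩ : ∃ z : ℝ, z = ((x : ℝ) - c) / (x + c) := ⟨_, rfl⟩
  have hz0 : 0 ≤ z := by rw [hz]; exact div_nonneg (by linarith) (by linarith)
  have hz1 : z < 1 := by rw [hz, div_lt_one (by linarith)]; linarith
  have hyz : (y : ℝ) ≤ 1000000 * z := by
    rw [hy, hz]
    refine Nat.cast_div_le.trans (le_of_eq ?_)
    push_cast [Nat.cast_sub hk]
    ring
  have hlog : Real.log (x / 1000000) = k * Real.log 2 + Real.log ((1 + z) / (1 - z)) := by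
    have e1 : (1 + z) / (1 - z) = x / c := by
      have : (x : ℝ) + c ≠ 0 := by linarith
      have h2 : 1 + z = 2 * x / (x + c) := by rw [hz]; field_simp; ring
      have h3 : 1 - z = 2 * c / (x + c) := by rw [hz]; field_simp; ring
      rw [h2, h3]
      field_simp
    rw [e1, ← Real.log_pow, ← Real.log_mul (by positivity) (by positivity), hcR]
    congr 1
    field_simp
  have h1 := two_mul_add_cube_le_log hz0 hz1
  have h2 : (0.693147 : ℝ) ≤ Real.log 2 := by have := Real.log_two_gt_d9; linarith
  have h3 : ((2 * y ^ 3 / 3000000000000 : ℕ) : ℝ) ≤ 1000000 * (2 * z ^ 3 / 3) := by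
    refine Nat.cast_div_le.trans ?_
    push_cast
    rw [div_le_iff₀ (by norm_num)]
    have : (y : ℝ) ^ 3 ≤ (1000000 * z) ^ 3 := by gcongr
    rw [mul_pow] at this
    linarith
  have h4 : (k : ℝ) * 0.693147 ≤ k * Real.log 2 := by gcongr
  push_cast at h3 ⊢
  rw [hlog]
  linarith

/-- The part `s + (log s)² / 2` that the two bounds for `ℓₙ / n` have in common, as a function of
`s = log n`. -/
noncomputable def mainTerm (s : ℝ) : ℝ := s + 1 / 2 * Real.log s ^ 2

theorem boundLower_le {n : ℕ} (hn : 1 ≤ n) :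
    (boundLower n : ℝ) ≤ 1000000 * (mainTerm (Real.log n) + 1) := by
  rw [boundLower_eq, mainTerm]
  have h1 := logLower_le (x := n * 1000000) (by omega)
  push_cast at h1
  rw [mul_div_assoc, div_self (by norm_num), mul_one] at h1
  generalize logLower (n * 1000000) = a at *
  have h2 : ((logLower a ^ 2 / 2000000 : ℕ) : ℝ) ≤ 1000000 * (1 / 2 * Real.log (Real.log n) ^ 2) := by
    rcases lt_or_ge a 1000000 with ha | ha
    · have : logLower a = 0 := by
        rw [logLower_eq, Nat.div_eq_of_lt ha, show Nat.log2 0 = 0 by rfl,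
          Nat.sub_eq_zero_of_le (by omega)]
        simp
      rw [this]
      simp only [ne_eq, OfNat.ofNat_ne_zero, not_false_eq_true, zero_pow, Nat.zero_div,
        Nat.cast_zero]
      positivity
    · have h3 := logLower_le ha
      have h4 : Real.log (a / 1000000) ≤ Real.log (Real.log n) := by
        have : (1000000 : ℝ) ≤ a := by exact_mod_cast ha
        refine Real.log_le_log (by positivity) ?_
        rw [div_le_iff₀ (by norm_num)]
        linarith
      refine Nat.cast_div_le.trans ?_
      push_cast
      have h5 : (logLower a : ℝ) ^ 2 ≤ (1000000 * Real.log (Real.log n)) ^ 2 := by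
        gcongr
        linarith
      rw [div_le_iff₀ (by norm_num)]
      rw [mul_pow] at h5
      linarith
  push_cast at h2 ⊢
  linarith

/-! ### Correctness of the computation -/

theorem mainTerm_mono {s t : ℝ} (hs : 1 ≤ s) (hst : s ≤ t) : mainTerm s ≤ mainTerm t := by
  have h1 : 0 ≤ Real.log s := Real.log_nonneg hs
  have h2 : Real.log s ≤ Real.log t := Real.log_le_log (by linarith) hst
  rw [mainTerm, mainTerm]
  gcongr

theorem one_le_log_of_three_le {n : ℕ} (hn : 3 ≤ n) : 1 ≤ Real.log n := by
  rw [Real.le_log_iff_exp_le (by exact_mod_cast (by omega : 0 < n))]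
  have h1 := Real.exp_one_lt_d9
  have h2 : (3 : ℝ) ≤ n := by exact_mod_cast hn
  linarith

theorem mainTerm_log_mono {m n : ℕ} (hm : 3 ≤ m) (hmn : m ≤ n) :
    mainTerm (Real.log m) ≤ mainTerm (Real.log n) := by
  refine mainTerm_mono (one_le_log_of_three_le hm) (Real.log_le_log ?_ (by exact_mod_cast hmn))
  exact_mod_cast (by omega : 0 < m)

/-- The list `[ℓ_M - 1, …, ℓ₂ - 1]`. -/
noncomputable def gapList : ℕ → List ℕ
  | 0 => []
  | 1 => []
  | m + 2 => (lucky (m + 2) - 1) :: gapList (m + 1)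

theorem gapList_succ {M : ℕ} (hM : 1 ≤ M) :
    gapList (M + 1) = (lucky (M + 1) - 1) :: gapList M := by
  obtain ⟨m, rfl⟩ := Nat.exists_eq_add_of_le' hM
  rfl

theorem survivor_eq_unsieve {M : ℕ} (hM : 1 ≤ M) {x : ℕ} (hx : 1 ≤ x) :
    survivor (M + 1) x = 2 * unsieve (gapList M) x + 1 := by
  induction M, hM using Nat.le_induction generalizing x with
  | base => rw [survivor_two, if_neg (by omega), gapList, unsieve_nil]
  | succ M hM ih =>
    rw [survivor_succ (by omega), gapList_succ hM, unsieve_cons,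
      ih (hx.trans (Nat.le_add_right _ _))]

theorem lucky_eq_unsieve {a n : ℕ} (ha : 2 ≤ a) (han : a ≤ n) (h : n < lucky (a + 1)) :
    lucky n = 2 * unsieve (gapList a) (n - 1) + 1 := by
  rw [← survivor_eq_unsieve (by omega) (by omega)]
  rcases han.eq_or_lt with rfl | han
  · have := lt_lucky ha
    rw [survivor_succ ha, Nat.div_eq_of_lt (by omega), add_zero, lucky_eq_survivor ha]
  · exact lucky_eq_survivor_of_lt (by omega) han h

theorem cast_div_le_cast_div_add_one (a : ℕ) {d : ℕ} (hd : 0 < d) :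
    (a : ℝ) / d ≤ ((a / d + 1 : ℕ) : ℝ) := by
  rw [div_le_iff₀ (by exact_mod_cast hd)]
  have := (Nat.lt_mul_div_succ a hd).le
  rw [mul_comm] at this
  exact_mod_cast this

/-- Bounds `lo` and `hi` for `10⁹ sieveProd B`, the claim for the indices up to `B`, and the bound
for `sieveProd` from which the claim follows for larger indices. -/
structure VerifiedUpTo (B lo hi : ℕ) : Prop where
  lo_le : (lo : ℝ) ≤ 10 ^ 9 * sieveProd B
  le_hi : 10 ^ 9 * sieveProd B ≤ (hi : ℝ)
  lucky_lt : ∀ n : ℕ, 4 ≤ n → n ≤ B → (lucky n : ℝ) < n * (mainTerm (Real.log n) + 1)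
  sieveProd_lt : ∀ M : ℕ, 21 ≤ M → M ≤ B → sieveProd M < mainTerm (Real.log (lucky M)) + 1

theorem VerifiedUpTo.succ {B lo hi d : ℕ} (hB : 2 ≤ B) (hv : VerifiedUpTo B lo hi)
    (hd : lucky (B + 1) = d + 1) (h : stepCheck (B + 1) d (hi * (d + 1) / d + 1) = true) :
    VerifiedUpTo (B + 1) (lo * (d + 1) / d) (hi * (d + 1) / d + 1) := by
  have h3 := three_le_lucky (m := B + 1) (by omega)
  have hd0 : (0 : ℝ) < d := by exact_mod_cast (by omega : 0 < d)
  have hw : sieveProd (B + 1) = sieveProd B * ((d + 1) / d) := by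
    rw [sieveProd_succ (by omega), hd]
    push_cast
    rw [add_sub_cancel_right]
  have hhi : 10 ^ 9 * sieveProd (B + 1) ≤ ((hi * (d + 1) / d + 1 : ℕ) : ℝ) := by
    refine le_trans ?_ (cast_div_le_cast_div_add_one _ (by omega))
    rw [hw, ← mul_assoc]
    push_cast
    rw [mul_div_assoc]
    have := hv.le_hi
    gcongr
  rw [stepCheck, Bool.and_eq_true, Bool.or_eq_true] at h
  obtain ⟨h1, h2⟩ := h
  refine ⟨?_, hhi, fun n hn4 hn => ?_, fun M hM21 hM => ?_⟩
  · refine Nat.cast_div_le.trans ?_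
    rw [hw, ← mul_assoc]
    push_cast
    rw [mul_div_assoc]
    have := hv.lo_le
    gcongr
  · rcases Nat.lt_or_ge n (B + 1) with hlt | hge
    · exact hv.lucky_lt n hn4 (by omega)
    · obtain rfl : n = B + 1 := by omega
      have h4 : (d + 1) * 1000000 < (B + 1) * boundLower (B + 1) := by
        simpa [Nat.blt_eq] using h1
      have h5 : ((d : ℝ) + 1) * 1000000 < ((B + 1 : ℕ) : ℝ) * boundLower (B + 1) := by
        exact_mod_cast h4
      have h6 := mul_le_mul_of_nonneg_left (boundLower_le (n := B + 1) (by omega))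
        (Nat.cast_nonneg (α := ℝ) (B + 1))
      rw [hd]
      push_cast at h5 h6 ⊢
      linarith
  · rcases Nat.lt_or_ge M (B + 1) with hlt | hge
    · exact hv.sieveProd_lt M hM21 (by omega)
    · obtain rfl : M = B + 1 := by omega
      have h4 : hi * (d + 1) / d + 1 < 1000 * boundLower (d + 1) := by
        rcases h2 with h2 | h2
        · exact absurd (Nat.le_of_ble_eq_true h2) (by omega)
        · simpa [Nat.blt_eq] using h2
      have h5 : ((hi * (d + 1) / d + 1 : ℕ) : ℝ) < 1000 * boundLower (d + 1) := by
        exact_mod_cast h4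
      have h6 := boundLower_le (n := d + 1) (by omega)
      rw [hd]
      linarith

theorem extendLoop_sound {A c : ℕ} (hA : 2 ≤ A) {k : List ℕ → ℕ → ℕ → Bool} {B lo hi : ℕ}
    (hAB : A ≤ B) (hc : B + c < lucky (A + 1)) (hv : VerifiedUpTo B lo hi)
    (h : extendLoop (gapList A) c B (gapList B) lo hi k = true) :
    ∃ lo' hi', VerifiedUpTo (B + c) lo' hi' ∧ k (gapList (B + c)) lo' hi' = true := by
  induction c generalizing B lo hi with
  | zero => exact ⟨lo, hi, hv, h⟩
  | succ c ih =>
    have hd := lucky_eq_unsieve (n := B + 1) hA (by omega) (by omega)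
    rw [Nat.add_sub_cancel] at hd
    rw [extendLoop_succ, Bool.and_eq_true] at h
    have hg := gapList_succ (M := B) (by omega)
    rw [hd, Nat.add_sub_cancel] at hg
    rw [← hg] at h
    rw [show B + (c + 1) = B + 1 + c by omega] at hc ⊢
    exact ih (by omega) hc (hv.succ (by omega) hd h.1) h.2

theorem extend_sound {B c lo hi : ℕ} (hB : 2 ≤ B) {k : List ℕ → ℕ → ℕ → Bool}
    (hv : VerifiedUpTo B lo hi) (h : extend B c (gapList B) lo hi k = true) :
    ∃ lo' hi', VerifiedUpTo (B + c) lo' hi' ∧ k (gapList (B + c)) lo' hi' = true := by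
  obtain ⟨m, rfl⟩ := Nat.exists_eq_add_of_le' hB
  have h' : (Nat.ble (m + 2 + c) (lucky (m + 2) - 1 + 1) &&
      extendLoop (gapList (m + 2)) c (m + 2) (gapList (m + 2)) lo hi k) = true := h
  rw [Bool.and_eq_true] at h'
  have h1 := Nat.le_of_ble_eq_true h'.1
  have h2 := lucky_lt_succ hB
  exact extendLoop_sound hB le_rfl (by omega) hv h'.2

/-- On a block of indices after `m` each factor of the product is at most `(1 - 1 / ℓₘ)⁻¹`, and
`(1 - 1 / ℓₘ) ^ i ≥ 1 - i / ℓₘ`. -/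
theorem sieveProd_add_le {m i : ℕ} (hm : 2 ≤ m) (hi : i < lucky m) :
    sieveProd (m + i) ≤ sieveProd m * (lucky m / (lucky m - i)) := by
  have hl := three_le_lucky_cast hm
  induction i with
  | zero =>
    have : (lucky m : ℝ) ≠ 0 := by linarith
    simp [div_self this]
  | succ i ih =>
    have hi' : (i : ℝ) + 1 < lucky m := by exact_mod_cast hi
    have h1 : (lucky m : ℝ) ≤ lucky (m + i + 1) := by
      exact_mod_cast lucky_mono hm (by omega)
    have h2 : (lucky (m + i + 1) : ℝ) / (lucky (m + i + 1) - 1) ≤ lucky m / (lucky m - 1) := by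
      rw [div_le_div_iff₀ (by linarith) (by linarith)]
      linarith
    rw [← add_assoc, sieveProd_succ (by omega)]
    calc sieveProd (m + i) * ((lucky (m + i + 1) : ℝ) / (lucky (m + i + 1) - 1))
        ≤ sieveProd m * (lucky m / (lucky m - i)) * (lucky m / (lucky m - 1)) := by
          have := (sieveProd_pos m).le
          have h3 : 0 ≤ (lucky m : ℝ) / (lucky m - i) := div_nonneg (by linarith) (by linarith)
          have h4 : 0 ≤ (lucky (m + i + 1) : ℝ) / (lucky (m + i + 1) - 1) :=
            div_nonneg (by linarith) (by linarith)
          exact mul_le_mul (ih (by omega)) h2 h4 (mul_nonneg this h3)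
      _ ≤ sieveProd m * (lucky m / (lucky m - (i + 1 : ℕ))) := by
          rw [mul_assoc]
          refine mul_le_mul_of_nonneg_left ?_ (sieveProd_pos m).le
          push_cast
          rw [div_mul_div_comm, div_le_div_iff₀ (mul_pos (by linarith) (by linarith))
            (by linarith)]
          have : 0 ≤ (lucky m : ℝ) * i := by positivity
          linarith

/-- A bound `hi` for `10⁹ sieveProd m`, the bound `1.385` for the growth rate on `[A, m]`, and the
bound for `sieveProd` on `[21, m]`. -/
structure SampledUpTo (A m hi : ℕ) : Prop where
  le_hi : 10 ^ 9 * sieveProd m ≤ (hi : ℝ)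
  sieveRate_le : ∀ j : ℕ, A ≤ j → j ≤ m → sieveRate j ≤ 1.385
  sieveProd_lt : ∀ M : ℕ, 21 ≤ M → M ≤ m → sieveProd M < mainTerm (Real.log (lucky M)) + 1

theorem SampledUpTo.next {A m m' hi hi' : ℕ} (hm : 2 ≤ m) (hs : SampledUpTo A m hi)
    (hmm : m ≤ m') (hm' : m' ≤ m + m / 64)
    (hhi : hi' = hi * lucky m / (lucky m - (m' - m)) + 1)
    (h1 : m' * hi' ≤ 1385000000 * lucky m) (h2 : hi' < 1000 * boundLower (lucky m)) :
    SampledUpTo A m' hi' := by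
  have hlt := lt_lucky hm
  have hl := three_le_lucky hm
  have hl' := three_le_lucky_cast hm
  obtain ⟨i, rfl⟩ := Nat.exists_eq_add_of_le hmm
  rw [Nat.add_sub_cancel_left] at hhi
  have hi1 : i < lucky m := by omega
  have hhi' : 10 ^ 9 * sieveProd (m + i) ≤ (hi' : ℝ) := by
    rw [hhi]
    refine le_trans ?_ (cast_div_le_cast_div_add_one _ (by omega))
    refine (mul_le_mul_of_nonneg_left (sieveProd_add_le hm hi1) (by positivity)).trans ?_
    push_cast [Nat.cast_sub hi1.le]
    rw [← mul_assoc, mul_div_assoc]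
    have h5 : (i : ℝ) < lucky m := by exact_mod_cast hi1
    have h6 : 0 ≤ (lucky m : ℝ) / (lucky m - i) := div_nonneg (by linarith) (by linarith)
    exact mul_le_mul_of_nonneg_right hs.le_hi h6
  have hbd : ∀ j, m ≤ j → j ≤ m + i → 10 ^ 9 * sieveProd j ≤ (hi' : ℝ) := fun j _ hj2 =>
    le_trans (mul_le_mul_of_nonneg_left (sieveProd_mono (by omega) hj2) (by positivity)) hhi'
  refine ⟨hhi', fun j hj1 hj2 => ?_, fun j hj1 hj2 => ?_⟩
  · rcases le_or_gt j m with hjm | hjm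
    · exact hs.sieveRate_le j hj1 hjm
    · have h3 := hbd j hjm.le hj2
      have h4 : ((m + i : ℕ) : ℝ) * hi' ≤ 1385000000 * lucky m := by exact_mod_cast h1
      have h5 : (lucky m : ℝ) ≤ lucky j := by exact_mod_cast lucky_mono hm hjm.le
      have h6 : (j : ℝ) ≤ ((m + i : ℕ) : ℝ) := by exact_mod_cast hj2
      rw [sieveRate, div_le_iff₀ (by linarith)]
      have h7 : (j : ℝ) * (10 ^ 9 * sieveProd j) ≤ ((m + i : ℕ) : ℝ) * hi' := by
        have := (sieveProd_pos j).le
        gcongr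
      linarith
  · rcases le_or_gt j m with hjm | hjm
    · exact hs.sieveProd_lt j hj1 hjm
    · have h3 := hbd j hjm.le hj2
      have h4 : (hi' : ℝ) < 1000 * boundLower (lucky m) := by exact_mod_cast h2
      have h5 := boundLower_le (n := lucky m) (by omega)
      have h6 := mainTerm_log_mono hl (lucky_mono hm hjm.le)
      linarith

theorem sampleLoop_sound {A N c : ℕ} (hA : 2 ≤ A) (hN : N < lucky (A + 1))
    {k : ℕ → ℕ → Bool} {m hi : ℕ} (hAm : A ≤ m) (hmN : m ≤ N) (hs : SampledUpTo A m hi)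
    (h : sampleLoop (gapList A) N c m hi k = true) :
    ∃ m' hi', SampledUpTo A m' hi' ∧ k m' hi' = true := by
  induction c generalizing m hi with
  | zero => exact ⟨m, hi, hs, h⟩
  | succ c ih =>
    have hl := lucky_eq_unsieve hA hAm (by omega)
    rw [sampleLoop_succ (gapList A) N c m hi k hl rfl rfl, Bool.and_eq_true,
      Bool.and_eq_true] at h
    obtain ⟨⟨h1, h2⟩, h3⟩ := h
    have hmm : m ≤ min (m + m / 64) N := le_min (Nat.le_add_right _ _) hmN
    refine ih (hAm.trans hmm) (min_le_right _ _)
      (hs.next (by omega) hmm (min_le_left _ _) rfl (Nat.le_of_ble_eq_true h1) ?_) h3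
    simpa [Nat.blt_eq] using h2

theorem lucky_three : lucky 3 = 7 := by
  rw [lucky_eq_survivor (by omega), survivor_succ le_rfl, lucky_two, survivor_two]
  rfl

theorem gapList_three : gapList 3 = [6, 2] := by
  simp [gapList, lucky_two, lucky_three]

theorem verifiedUpTo_three : VerifiedUpTo 3 3500000000 3500000000 := by
  have h : sieveProd 3 = 7 / 2 := by
    rw [sieveProd_succ (by omega), sieveProd_succ le_rfl, sieveProd_one, lucky_three, lucky_two]
    norm_num
  refine ⟨?_, ?_, fun n h1 h2 => by omega, fun n h1 h2 => by omega⟩ <;> rw [h] <;> norm_num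

theorem finalCheck_sound {lo hi : ℕ} (hv : VerifiedUpTo 3000 lo hi)
    (h : finalCheck (gapList 3000) lo hi = true) :
    13.39 ≤ sieveProd 3000 ∧ lucky 3000 = 30367 ∧ ∃ hi', SampledUpTo 3000 30367 hi' ∧
      sieveProd 30367 ≤ 16.44 := by
  have h' : ((Nat.ble 13390000000 lo && Nat.ble (3000 * hi) (1385000000 * 30367)) &&
    (Nat.beq (lucky 3000 - 1) 30366 && sampleLoop (gapList 3000) 30367 150 3000 hi
      fun m h => Nat.beq m 30367 && Nat.ble h 16440000000)) = true := h
  simp only [Bool.and_eq_true] at h'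
  obtain ⟨⟨h1, h2⟩, h3, h4⟩ := h'
  have hl : lucky 3000 = 30367 := by
    have := Nat.eq_of_beq_eq_true h3
    have := three_le_lucky (m := 3000) (by norm_num)
    omega
  have hl' : (lucky 3000 : ℝ) = 30367 := by rw [hl]; norm_num
  have h1' : (13390000000 : ℝ) ≤ lo := by exact_mod_cast Nat.le_of_ble_eq_true h1
  have h2' : (3000 : ℝ) * hi ≤ 1385000000 * 30367 := by
    exact_mod_cast Nat.le_of_ble_eq_true h2
  have hs : SampledUpTo 3000 3000 hi := by
    refine ⟨hv.le_hi, fun j hj1 hj2 => ?_, hv.sieveProd_lt⟩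
    obtain rfl := le_antisymm hj2 hj1
    rw [sieveRate, hl', div_le_iff₀ (by norm_num)]
    have := hv.le_hi
    push_cast
    linarith
  have hlt := lucky_lt_succ (m := 3000) (by norm_num)
  obtain ⟨m', hi', hs', h5⟩ := sampleLoop_sound (by norm_num) (by omega) le_rfl (by norm_num) hs h4
  rw [Bool.and_eq_true] at h5
  obtain rfl := Nat.eq_of_beq_eq_true h5.1
  have h6 : (hi' : ℝ) ≤ 16440000000 := by exact_mod_cast Nat.le_of_ble_eq_true h5.2
  refine ⟨?_, hl, hi', hs', ?_⟩
  · have := hv.lo_le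
    linarith
  · have := hs'.le_hi
    linarith

theorem wholeCheck_eq_true : wholeCheck = true := by decide +kernel

theorem exists_verifiedUpTo :
    ∃ lo hi, VerifiedUpTo 3000 lo hi ∧ finalCheck (gapList 3000) lo hi = true := by
  have h := wholeCheck_eq_true
  rw [wholeCheck, ← gapList_three] at h
  obtain ⟨lo, hi, hv, h⟩ := extend_sound (by norm_num) verifiedUpTo_three h
  obtain ⟨lo, hi, hv, h⟩ := extend_sound (by norm_num) hv h
  obtain ⟨lo, hi, hv, h⟩ := extend_sound (by norm_num) hv h
  obtain ⟨lo, hi, hv, h⟩ := extend_sound (by norm_num) hv h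
  exact extend_sound (by norm_num) hv h

theorem lucky_lt_of_le {n : ℕ} (h4 : 4 ≤ n) (hn : n ≤ 3000) :
    (lucky n : ℝ) < n * (mainTerm (Real.log n) + 1) := by
  obtain ⟨lo, hi, hv, -⟩ := exists_verifiedUpTo
  exact hv.lucky_lt n h4 hn

theorem initial_data : 13.39 ≤ sieveProd 3000 ∧ lucky 3000 = 30367 ∧
    ∃ hi, SampledUpTo 3000 30367 hi ∧ sieveProd 30367 ≤ 16.44 := by
  obtain ⟨lo, hi, hv, h⟩ := exists_verifiedUpTo
  exact finalCheck_sound hv h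

/-! ### Bounds for the growth rate -/

theorem le_sieveProd {a : ℕ} (ha : 3000 ≤ a) : 13.39 ≤ sieveProd a :=
  initial_data.1.trans (sieveProd_mono (by norm_num) ha)

/-- If `m > 30367 = ℓ₃₀₀₀`, then at least `3000` of the `ℓᵢ` are at most `m`. So at the indices where
`sieveRate_le` is applied, the bounds at the indices from `3000` on suffice as input. -/
theorem lucky_le_and_lt_of_lt {m : ℕ} (hm : 30367 < m) :
    ∃ a, 3000 ≤ a ∧ a < m ∧ lucky a ≤ m ∧ m < lucky (a + 1) := by
  obtain ⟨a, ha, ham, h1, h2⟩ := exists_lucky_le_lt (n := m) (by omega)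
  refine ⟨a, ?_, ham, h1, h2⟩
  by_contra! h
  have h3 := lucky_mono (m := a + 1) (n := 3000) (by omega) (by omega)
  rw [initial_data.2.1] at h3
  omega

theorem log_sixteen : Real.log 16 = 4 * Real.log 2 := by
  rw [show (16 : ℝ) = 2 ^ 4 by norm_num, Real.log_pow]
  norm_num

theorem log_le_div_sixteen {u : ℝ} (hu : 0 < u) : Real.log u ≤ 1.7726 + u / 16 := by
  have h1 := Real.log_le_sub_one_of_pos (x := u / 16) (by positivity)
  rw [Real.log_div hu.ne' (by norm_num), log_sixteen] at h1
  have := Real.log_two_lt_d9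
  linarith

/-- The constant `1.385` reproduces itself in the recursion because
`1 + 1.385 log u ≤ 0.385 (u - 1.385)` for `u ≥ 13.39`. -/
theorem sieveRate_le_const {j : ℕ} (hj : 3000 ≤ j) : sieveRate j ≤ 1.385 := by
  induction j using Nat.strong_induction_on with
  | _ j ih =>
    obtain ⟨hi, hs, -⟩ := initial_data.2.2
    rcases le_or_gt j 30367 with h | h
    · exact hs.sieveRate_le j hj h
    · obtain ⟨a, ha, haj, h1, h2⟩ := lucky_le_and_lt_of_lt h
      have hu := le_sieveProd ha
      refine (sieveRate_le (Q := 1.385) (by omega) haj h1 h2 (by norm_num) (by linarith)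
        fun i hi1 hi2 => ih i hi2 (by omega)).trans ?_
      have h3 := log_le_div_sixteen (sieveProd_pos a)
      have h4 : (1 + 1.385 * Real.log (sieveProd a)) / (sieveProd a - 1.385) ≤ 0.385 := by
        rw [div_le_iff₀ (by linarith)]
        linarith
      linarith

/-- A decreasing bound for the growth rate at `j` in terms of `x = sieveProd j`. The constants
`2` and `8` leave room for the terms of size `(log x) ^ 2 / x ^ 2` produced by the recursion. -/
noncomputable def rateBound (x : ℝ) : ℝ := 1 + (Real.log x + 2) / (x - 8)

theorem rateBound_anti {x y : ℝ} (hx : 8 < x) (hxy : x ≤ y) : rateBound y ≤ rateBound x := by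
  have hl : 0 ≤ Real.log x := Real.log_nonneg (by linarith)
  have h1 := Real.log_le_sub_one_of_pos (x := y / x) (div_pos (by linarith) (by linarith))
  rw [Real.log_div (by linarith) (by linarith)] at h1
  have h2 : (x - 8) * (y / x - 1) ≤ y - x := by
    have : y / x - 1 = (y - x) / x := by field_simp
    rw [this, mul_div_assoc', div_le_iff₀ (by linarith)]
    nlinarith
  have h3 : (Real.log y - Real.log x) * (x - 8) ≤ (y / x - 1) * (x - 8) :=
    mul_le_mul_of_nonneg_right h1 (by linarith)
  have h4 : 0 ≤ Real.log x * (y - x) := mul_nonneg hl (by linarith)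
  rw [rateBound, rateBound, add_le_add_iff_left, div_le_div_iff₀ (by linarith) (by linarith)]
  linarith

theorem log_twentyOne_mem : 3.01 ≤ Real.log 21 ∧ Real.log 21 ≤ 3.086 := by
  have h1 := log_le_div_sixteen (u := 21) (by norm_num)
  have h2 := Real.one_sub_inv_le_log_of_pos (x := 21 / 16) (by norm_num)
  rw [Real.log_div (by norm_num) (by norm_num), log_sixteen] at h2
  have := Real.log_two_gt_d9
  constructor <;> norm_num at h1 h2 ⊢ <;> linarith

/-- With `L = log u`: inserting the rate bound `1.385` into the recursion gives at most `rateBound` at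
`u + 1.385 L`, in the range where `1.385` is the better bound at `u`. -/
theorem rateBound_step_of_le {u L : ℝ} (hu : 13.39 ≤ u) (hu' : u ≤ 21) (hL0 : 2.5 ≤ L)
    (hL : L ≤ 3.086) :
    (1 + 1.385 * L) * (u + 1.385 * L - 8) ≤ (L + 2) * (u - 1.385) := by
  have h1 : 0 ≤ (21 - u) * (L - 2.5) := mul_nonneg (by linarith) (by linarith)
  have h2 : 0 ≤ (3.086 - L) * (L - 2.5) := mul_nonneg (by linarith) (by linarith)
  nlinarith

/-- With `L = log u` and `1 + g = rateBound u`: `rateBound` reproduces itself in the recursion. -/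
theorem rateBound_step_of_ge {u L g : ℝ} (hu : 21 ≤ u) (hLu : L = Real.log u)
    (hg : g = (L + 2) / (u - 8)) :
    (1 + (1 + g) * L) * (u + 1.385 * L - 8) ≤ (L + 2) * (u - (1 + g)) := by
  have hL3 : 3.01 ≤ L := hLu ▸ log_twentyOne_mem.1.trans (Real.log_le_log (by norm_num) hu)
  have hg0 : 0 ≤ g := hg ▸ div_nonneg (by linarith) (by linarith)
  have hg1 : g ≤ 0.3913 := by
    have h1 := rateBound_anti (by norm_num) hu
    have h2 := log_twentyOne_mem.2
    rw [rateBound, rateBound, ← hLu, ← hg] at h1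
    norm_num at h1
    linarith
  have hgu : g * u ≤ (L + 2) * (21 / 13) := by
    rw [hg, div_mul_eq_mul_div, div_le_iff₀ (by linarith)]
    have : 0 ≤ (L + 2) * (u - 21) := mul_nonneg (by linarith) (by linarith)
    linarith
  -- `u = exp 3 * exp (L - 3)` dominates the quadratic polynomial in `L`
  have hu2 : 20 * (1 + (L - 3) + (L - 3) ^ 2 / 2) ≤ u := by
    have h1 := Real.quadratic_le_exp_of_nonneg (x := L - 3) (by linarith)
    have h2 : Real.exp L = u := by rw [hLu, Real.exp_log (by linarith)]
    have h3 : (20 : ℝ) ≤ Real.exp 3 := by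
      have h4 := Real.exp_one_gt_d9
      have h5 : Real.exp 3 = Real.exp 1 ^ 3 := by rw [← Real.exp_nat_mul]; norm_num
      rw [h5]
      calc (20 : ℝ) ≤ 2.7182818283 ^ 3 := by norm_num
        _ ≤ _ := by gcongr
    rw [← h2, show L = 3 + (L - 3) by ring, Real.exp_add]
    have h6 : (0 : ℝ) ≤ 1 + (L - 3) + (L - 3) ^ 2 / 2 := by
      have : 0 ≤ L - 3 := by linarith
      positivity
    calc 20 * (1 + (3 + (L - 3) - 3) + (3 + (L - 3) - 3) ^ 2 / 2)
        = 20 * (1 + (L - 3) + (L - 3) ^ 2 / 2) := by ring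
      _ ≤ Real.exp 3 * Real.exp (L - 3) := by gcongr
  have h1 : g * u * L ≤ (L + 2) * (21 / 13) * L :=
    mul_le_mul_of_nonneg_right hgu (by linarith)
  have h2 : g * L ^ 2 ≤ 0.3913 * L ^ 2 := mul_le_mul_of_nonneg_right hg1 (by positivity)
  have h3 : 0 ≤ g * (7 * L - 2) := mul_nonneg hg0 (by linarith)
  nlinarith

theorem sieveRate_le_rateBound {j : ℕ} (hj : 3000 ≤ j) :
    sieveRate j ≤ rateBound (sieveProd j) := by
  induction j using Nat.strong_induction_on with
  | _ j ih =>
    obtain ⟨hi, -, hN⟩ := initial_data.2.2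
    rcases le_or_gt (sieveProd j) 21 with h | h
    · refine (sieveRate_le_const hj).trans (le_trans ?_
        (rateBound_anti (by linarith [le_sieveProd hj]) h))
      have := log_twentyOne_mem.1
      rw [rateBound]
      norm_num at this ⊢
      linarith
    · have hjN : 30367 < j := by
        by_contra! hle
        have := sieveProd_mono (by omega) hle
        linarith
      obtain ⟨a, ha, haj, h1, h2⟩ := lucky_le_and_lt_of_lt hjN
      have hu := le_sieveProd ha
      obtain ⟨u, hu_def⟩ : ∃ u, u = sieveProd a := ⟨_, rfl⟩
      rw [← hu_def] at hu
      have hu0 : 0 < u := by linarith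
      have hL0 : 2.5 ≤ Real.log u := by
        have h5 := Real.one_sub_inv_le_log_of_pos (x := u / 16) (by positivity)
        rw [Real.log_div hu0.ne' (by norm_num), inv_div, log_sixteen] at h5
        have h7 := Real.log_two_gt_d9
        have h8 : 16 / u ≤ 1.2 := by
          rw [div_le_iff₀ hu0]
          linarith
        linarith
      have hx : sieveProd j ≤ u + 1.385 * Real.log u := by
        refine (sieveProd_le_add_log (by omega) haj.le (by norm_num)
          fun i h3 h4 => sieveRate_le_const (by omega)).trans ?_
        rw [← hu_def]
        have h3 := lucky_sub_one_le (n := a) (by omega)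
        have h4 : (j : ℝ) + 1 ≤ lucky (a + 1) := by exact_mod_cast h2
        have ha0 : (0 : ℝ) < a := by exact_mod_cast (by omega : 0 < a)
        have hj0 : (0 : ℝ) < j := by exact_mod_cast (by omega : 0 < j)
        have h5 : Real.log j ≤ Real.log (a * u) :=
          Real.log_le_log hj0 (by rw [hu_def]; linarith)
        rw [Real.log_mul ha0.ne' hu0.ne'] at h5
        linarith
      refine le_trans ?_ (rateBound_anti (by linarith) hx)
      have hLx : Real.log u ≤ Real.log (u + 1.385 * Real.log u) :=
        Real.log_le_log hu0 (by linarith)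
      -- it remains to compare the bound of the recursion with `rateBound`
      suffices H : ∃ Q : ℝ, 1 ≤ Q ∧ Q < u ∧ (∀ i, a ≤ i → i < j → sieveRate i ≤ Q) ∧
          (1 + Q * Real.log u) * (u + 1.385 * Real.log u - 8) ≤
            (Real.log u + 2) * (u - Q) by
        obtain ⟨Q, hQ1, hQu, hQ, hstep⟩ := H
        refine (sieveRate_le (by omega) haj h1 h2 hQ1 (hu_def ▸ hQu) hQ).trans ?_
        rw [← hu_def, rateBound, add_le_add_iff_left,
          div_le_div_iff₀ (by linarith) (by linarith)]
        refine hstep.trans ?_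
        exact mul_le_mul_of_nonneg_right (by linarith) (by linarith)
      rcases le_or_gt u 21 with hu21 | hu21
      · refine ⟨1.385, by norm_num, by linarith,
          fun i h3 h4 => sieveRate_le_const (by omega), ?_⟩
        refine rateBound_step_of_le hu hu21 hL0 ?_
        exact (Real.log_le_log hu0 hu21).trans log_twentyOne_mem.2
      · have hg0 : 0 ≤ (Real.log u + 2) / (u - 8) := div_nonneg (by linarith) (by linarith)
        refine ⟨rateBound u, ?_, ?_, fun i h3 h4 => ?_,
          rateBound_step_of_ge hu21.le rfl rfl⟩
        · rw [rateBound]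
          linarith
        · have h5 := rateBound_anti (by norm_num) hu21.le
          have h6 := log_twentyOne_mem.2
          have h7 : rateBound 21 ≤ 2 := by
            rw [rateBound]
            norm_num at h6 ⊢
            linarith
          linarith
        · refine (ih i h4 (by omega)).trans (rateBound_anti (by linarith) ?_)
          rw [hu_def]
          exact sieveProd_mono (by omega) h3

/-! ### Numerical values of the logarithm -/

theorem div_le_log_of_le_logLower {x c : ℕ} (hx : 1000000 ≤ x) (h : c ≤ logLower x) :
    (c : ℝ) / 1000000 ≤ Real.log (x / 1000000) := by
  have h1 := logLower_le hx
  have h2 : (c : ℝ) ≤ logLower x := by exact_mod_cast h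
  rw [div_le_iff₀ (by norm_num)]
  linarith

theorem log_3000_le : Real.log 3000 ≤ 8.0065 := by
  have h1 := div_le_log_of_le_logLower (x := 1365333) (c := 311300) (by norm_num) (by decide +kernel)
  have h2 : Real.log (1365333 / 1000000) ≤ Real.log (2 ^ 12 / 3000) :=
    Real.log_le_log (by norm_num) (by norm_num)
  rw [Real.log_div (x := 2 ^ 12) (by norm_num) (by norm_num), Real.log_pow] at h2
  have := Real.log_two_lt_d9
  norm_num at h1 h2 ⊢
  linarith

theorem log_ten_pow_le : Real.log (10 ^ 7) ≤ 16.12 := by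
  have h1 := div_le_log_of_le_logLower (x := 1677721) (c := 516000) (by norm_num) (by decide +kernel)
  have h2 : Real.log (1677721 / 1000000) ≤ Real.log (2 ^ 24 / 10 ^ 7) :=
    Real.log_le_log (by norm_num) (by norm_num)
  rw [Real.log_div (x := 2 ^ 24) (by norm_num) (by norm_num), Real.log_pow] at h2
  have := Real.log_two_lt_d9
  norm_num at h1 h2 ⊢
  linarith

theorem le_log_30367 : 10.32 ≤ Real.log 30367 := by
  have h1 := div_le_log_of_le_logLower (x := 30367000000) (c := 10320000) (by norm_num) (by decide +kernel)
  norm_num at h1 ⊢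
  linarith

theorem le_log_14_4 : 2.6662 ≤ Real.log 14.4 := by
  have h1 := div_le_log_of_le_logLower (x := 14400000) (c := 2666200) (by norm_num) (by decide +kernel)
  norm_num at h1 ⊢
  linarith

theorem le_log_12_491 : 2.5245 ≤ Real.log 12.491 := by
  have h1 := div_le_log_of_le_logLower (x := 12491000) (c := 2524500) (by norm_num) (by decide +kernel)
  norm_num at h1 ⊢
  linarith

theorem two_le_log_7_6 : 2 ≤ Real.log 7.6 := by
  have h1 := div_le_log_of_le_logLower (x := 7600000) (c := 2000000) (by norm_num) (by decide +kernel)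
  norm_num at h1 ⊢
  linarith

/-! ### Summing the growth rate -/

theorem log_add_le_sieveProd {m : ℕ} (hm : 3000 ≤ m) : Real.log m + 5.38 ≤ sieveProd m := by
  have h1 := sieveProd_add_log_le (by norm_num) hm
  have h2 := le_sieveProd le_rfl
  have h3 := log_3000_le
  push_cast at h1
  linarith

theorem le_log_cast {m : ℕ} (hm : 30367 ≤ m) : 10.32 ≤ Real.log m :=
  le_log_30367.trans (Real.log_le_log (by norm_num) (by exact_mod_cast hm))

/-- Since `sieveRate m ≤ 1.385`, the `m`-th lucky number is at least `m * sieveProd m / 1.385`. -/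
theorem log_add_log_le_log_lucky {m : ℕ} (hm : 30367 ≤ m) :
    Real.log m + Real.log ((Real.log m + 5.38) / 1.385) ≤ Real.log (lucky m) := by
  have h1 := sieveRate_le_const (j := m) (by omega)
  have h2 := log_add_le_sieveProd (m := m) (by omega)
  have h3 := three_le_lucky_cast (m := m) (by omega)
  have h4 := le_log_cast hm
  have hm0 : (0 : ℝ) < m := by exact_mod_cast (by omega : 0 < m)
  rw [sieveRate, div_le_iff₀ (by linarith)] at h1
  have h5 : 0 < (Real.log m + 5.38) / 1.385 := div_pos (by linarith) (by norm_num)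
  rw [← Real.log_mul hm0.ne' h5.ne']
  refine Real.log_le_log (by positivity) ?_
  rw [← mul_div_assoc, div_le_iff₀ (by norm_num)]
  have h6 : (m : ℝ) * (Real.log m + 5.38) ≤ m * sieveProd m := by gcongr
  linarith

/-- The primitive used to sum `rateBound`; its derivative at `t` is at least
`rateBound (t + 5.38)`. -/
noncomputable def rateSum (t : ℝ) : ℝ :=
  t + 1 / 2 * Real.log (t - 2.62) ^ 2 + 2 * Real.log (t - 2.62) - 8 / (t - 2.62)

theorem hasDerivAt_rateSum {t : ℝ} (ht : 2.62 < t) :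
    HasDerivAt rateSum (1 + Real.log (t - 2.62) / (t - 2.62) + 2 / (t - 2.62) +
      8 / (t - 2.62) ^ 2) t := by
  have hz : t - 2.62 ≠ 0 := by linarith
  have h1 : HasDerivAt (fun t : ℝ => t - 2.62) 1 t := (hasDerivAt_id t).sub_const _
  have h2 := h1.log hz
  have h3 := ((hasDerivAt_id t).add ((h2.pow 2).const_mul (1 / 2))).add (h2.const_mul 2)
  have h4 := h3.sub ((hasDerivAt_const t (8 : ℝ)).div h1 hz)
  refine (h4.congr_of_eventuallyEq (Filter.Eventually.of_forall fun x => ?_)).congr_deriv ?_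
  · simp [rateSum]
  · field_simp
    ring

theorem rateBound_le_deriv {t : ℝ} (ht : 2.62 < t) :
    rateBound (t + 5.38) ≤ 1 + Real.log (t - 2.62) / (t - 2.62) + 2 / (t - 2.62) +
      8 / (t - 2.62) ^ 2 := by
  obtain ⟨z, hz⟩ : ∃ z, z = t - 2.62 := ⟨_, rfl⟩
  have hz0 : 0 < z := by linarith
  have h1 := Real.log_le_sub_one_of_pos (x := (z + 8) / z) (by positivity)
  rw [Real.log_div (by linarith) hz0.ne'] at h1
  have h2 : (z + 8) / z - 1 = 8 / z := by field_simp; ring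
  rw [rateBound, ← hz, show t + 5.38 = z + 8 by rw [hz]; ring, add_sub_cancel_right]
  have h3 : Real.log (z + 8) + 2 ≤ Real.log z + 2 + 8 / z := by linarith
  calc 1 + (Real.log (z + 8) + 2) / z ≤ 1 + (Real.log z + 2 + 8 / z) / z := by gcongr
    _ = _ := by field_simp; ring

theorem sieveProd_le_rateSum {m : ℕ} (hm : 30367 ≤ m) :
    sieveProd m ≤ sieveProd 30367 + (rateSum (Real.log m) - rateSum (Real.log 30367)) := by
  induction m, hm using Nat.le_induction with
  | base => push_cast; linarith
  | succ m hm ih =>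
    have hm0 : (0 : ℝ) < m := by exact_mod_cast (by omega : 0 < m)
    have ht := le_log_cast hm
    have hlog : ∀ y, (m : ℝ) ≤ y → 10.32 ≤ Real.log y := fun y hy =>
      ht.trans (Real.log_le_log hm0 hy)
    have hder : ∀ y, (m : ℝ) ≤ y → HasDerivAt (fun y => rateSum (Real.log y))
        ((1 + Real.log (Real.log y - 2.62) / (Real.log y - 2.62) + 2 / (Real.log y - 2.62) +
          8 / (Real.log y - 2.62) ^ 2) * y⁻¹) y := fun y hy =>
      HasDerivAt.comp y (hasDerivAt_rateSum (by linarith [hlog y hy]))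
        (Real.hasDerivAt_log (by linarith))
    obtain ⟨y, hy, hslope⟩ := exists_hasDerivAt_eq_slope _ _ (show (m : ℝ) < m + 1 by linarith)
      (fun y hy => (hder y hy.1).continuousAt.continuousWithinAt)
      (fun y hy => hder y hy.1.le)
    rw [add_sub_cancel_left, div_one] at hslope
    have h1 := sieveRate_le_rateBound (j := m + 1) (by omega)
    have h2 := log_add_le_sieveProd (m := m + 1) (by omega)
    have h3 := sieveProd_succ_eq_add (M := m) (by omega)
    push_cast at h2 ⊢
    have h4 : sieveRate (m + 1) ≤ rateBound (Real.log y + 5.38) := by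
      refine h1.trans (rateBound_anti ?_ (le_trans ?_ h2))
      · linarith [hlog y hy.1.le]
      · have := Real.log_le_log (by linarith [hy.1]) hy.2.le
        linarith
    have h5 := h4.trans (rateBound_le_deriv (by linarith [hlog y hy.1.le]))
    have hr0 : 0 ≤ sieveRate (m + 1) := by
      have := (sieveProd_pos (m + 1)).le
      rw [sieveRate]
      positivity
    have h6 : sieveRate (m + 1) / (m + 1) ≤
        (1 + Real.log (Real.log y - 2.62) / (Real.log y - 2.62) + 2 / (Real.log y - 2.62) +
          8 / (Real.log y - 2.62) ^ 2) * y⁻¹ := by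
      rw [div_eq_mul_inv]
      have hy0 : 0 < y := by linarith [hy.1]
      have : ((m : ℝ) + 1)⁻¹ ≤ y⁻¹ := inv_anti₀ hy0 hy.2.le
      exact mul_le_mul h5 this (by positivity) (hr0.trans h5)
    rw [hslope] at h6
    linarith

/-- Here `sieveProd` is estimated by the constant rate `1.385`. The tangents to `log` at `12.491` and
`14.4` reduce the claim to linear bounds in `T = log m - 10.32`, which suffice for `T ≤ 3.4`; this
covers `ℓₘ ≤ 10 ^ 7`. -/
theorem sieveProd_lt_of_lucky_le {m : ℕ} (hm : 30367 ≤ m) (hl : lucky m ≤ 10 ^ 7) :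
    sieveProd m < mainTerm (Real.log (lucky m)) + 1 := by
  obtain ⟨hi, -, hN⟩ := initial_data.2.2
  have h1 := sieveProd_le_add_log (a := 30367) (by norm_num) hm (Q := 1.385) (by norm_num)
    fun j h3 h4 => sieveRate_le_const (by omega)
  have h2 := log_add_log_le_log_lucky hm
  have h3 := le_log_cast hm
  have h4 := le_log_30367
  push_cast at h1
  have h5 : Real.log (lucky m) ≤ 16.12 := by
    refine (Real.log_le_log ?_ ?_).trans log_ten_pow_le
    · linarith [three_le_lucky_cast (m := m) (by omega)]
    · exact_mod_cast hl
  obtain ⟨T, hT⟩ : ∃ T, T = Real.log m - 10.32 := ⟨_, rfl⟩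
  have hT0 : 0 ≤ T := by linarith
  generalize Real.log (lucky m) = s at *
  have hlog : Real.log m = T + 10.32 := by linarith
  rw [hlog] at h1 h2
  have h6 : 3.5245 - 17.3001 / (T + 15.7) ≤ Real.log ((T + 10.32 + 5.38) / 1.385) := by
    have h7 := Real.one_sub_inv_le_log_of_pos (x := (T + 10.32 + 5.38) / 1.385 / 12.491)
      (by positivity)
    rw [Real.log_div (by positivity) (by norm_num)] at h7
    have h8 := le_log_12_491
    have h9 : ((T + 10.32 + 5.38) / 1.385 / 12.491)⁻¹ ≤ 17.3001 / (T + 15.7) := by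
      rw [div_div, inv_div]
      have : T + 10.32 + 5.38 = T + 15.7 := by ring
      rw [this]
      gcongr
      norm_num
    linarith
  have h7 : ∀ T' : ℝ, 0 ≤ T' → T' ≤ 3.4 → 2.42 + 0.0576 * T' ≤ 3.5245 - 17.3001 / (T' + 15.7) := by
    intro T' h0 h34
    have : 17.3001 / (T' + 15.7) ≤ 1.1045 - 0.0576 * T' := by
      rw [div_le_iff₀ (by positivity)]
      nlinarith
    linarith
  have hT4 : T ≤ 3.4 := by
    have h8 : 17.3001 / (T + 15.7) ≤ 17.3001 / 15.7 := by gcongr; linarith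
    norm_num at h8
    linarith
  have h8 := h7 T hT0 hT4
  have hs : 12.7399 + 1.0576 * T ≤ s := by linarith
  have hs0 : 0 < s := by linarith
  have h9 : 2.5355 + 0.073 * T ≤ Real.log s := by
    have h10 := Real.one_sub_inv_le_log_of_pos (x := s / 14.4) (by positivity)
    rw [Real.log_div hs0.ne' (by norm_num), inv_div] at h10
    have h11 := le_log_14_4
    have h12 : 14.4 / s ≤ 1.1307 - 0.073 * T := by
      rw [div_le_iff₀ hs0]
      have : 14.4 ≤ (1.1307 - 0.073 * T) * (12.7399 + 1.0576 * T) := by nlinarith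
      refine this.trans ?_
      exact mul_le_mul_of_nonneg_left hs (by linarith)
    linarith
  have h10 : (2.5355 + 0.073 * T) ^ 2 ≤ Real.log s ^ 2 := by gcongr
  rw [mainTerm]
  nlinarith

/-- With `t = log m`, the sum of `rateBound` grows like `t + (log t)² / 2 + 2 log t`, while
`log ℓₘ ≥ t + log t - 0.385`; so the coefficient of `log log ℓₘ` needed is about `1 < 1.238645`. -/
theorem sieveProd_lt_of_le {m : ℕ} (hm : 30367 ≤ m) :
    sieveProd m < mainTerm (Real.log (lucky m)) + 1.238645 * Real.log (Real.log (lucky m)) +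
      3.015516 := by
  obtain ⟨hi, -, hN⟩ := initial_data.2.2
  have h1 := sieveProd_le_rateSum hm
  have h2 := log_add_log_le_log_lucky hm
  have h3 := le_log_cast hm
  have h4 := le_log_30367
  obtain ⟨t, ht⟩ : ∃ t, t = Real.log m := ⟨_, rfl⟩
  rw [← ht] at h1 h2 h3
  have hsum0 : 15.2 ≤ rateSum (Real.log 30367) := by
    obtain ⟨t₀, ht₀⟩ : ∃ t, t = Real.log 30367 := ⟨_, rfl⟩
    rw [← ht₀] at h4 ⊢
    have h5 : 2 ≤ Real.log (t₀ - 2.62) :=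
      two_le_log_7_6.trans (Real.log_le_log (by norm_num) (by linarith))
    have h6 : 8 / (t₀ - 2.62) ≤ 8 / 7.6 := by gcongr; linarith
    have h7 : 2 ^ 2 ≤ Real.log (t₀ - 2.62) ^ 2 := by gcongr
    rw [rateSum]
    norm_num at h6
    linarith
  have hsum : rateSum t ≤ t + 1 / 2 * Real.log t ^ 2 + 2 * Real.log t := by
    have h5 : 0 ≤ Real.log (t - 2.62) := Real.log_nonneg (by linarith)
    have h6 : Real.log (t - 2.62) ≤ Real.log t := Real.log_le_log (by linarith) (by linarith)
    have h7 : 0 ≤ 8 / (t - 2.62) := div_nonneg (by norm_num) (by linarith)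
    have h8 : Real.log (t - 2.62) ^ 2 ≤ Real.log t ^ 2 := by gcongr
    rw [rateSum]
    linarith
  have hlt : 0 ≤ Real.log t := Real.log_nonneg (by linarith)
  have hs : t + Real.log t - 0.385 ≤ Real.log (lucky m) := by
    refine le_trans ?_ h2
    have h5 : Real.log t ≤ Real.log (t + 5.38) := Real.log_le_log (by linarith) (by linarith)
    have h6 := Real.log_le_sub_one_of_pos (x := 1.385) (by norm_num)
    rw [Real.log_div (by linarith) (by norm_num)]
    linarith
  have hlog : Real.log t ≤ Real.log (Real.log (lucky m)) := by
    have h5 := two_le_log_7_6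
    have h6 : Real.log 7.6 ≤ Real.log t := Real.log_le_log (by norm_num) (by linarith)
    exact Real.log_le_log (by linarith) (by linarith)
  have hsq : Real.log t ^ 2 ≤ Real.log (Real.log (lucky m)) ^ 2 := by gcongr
  rw [mainTerm]
  linarith

/-! ### The two inequalities -/

theorem lucky_twentyOne_le : lucky 21 ≤ 3000 := by
  have h1 := lucky_lt_of_le (n := 21) (by norm_num) (by norm_num)
  push_cast at h1
  have h2 := log_twentyOne_mem
  have h3 := Real.log_le_sub_one_of_pos (x := Real.log 21) (by linarith)
  have h4 : 0 ≤ Real.log (Real.log 21) := Real.log_nonneg (by linarith)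
  have h5 : Real.log (Real.log 21) ^ 2 ≤ 3 ^ 2 := by
    gcongr
    linarith
  have h6 : (lucky 21 : ℝ) ≤ 3000 := by
    rw [mainTerm] at h1
    linarith
  exact_mod_cast h6

/-- The bound `ℓₙ ≤ n * sieveProd M` with `M` the number of `ℓᵢ ≤ n`. -/
theorem lucky_lt_mul_of_sieveProd_lt {M n : ℕ} {B : ℝ} (hM : 1 ≤ M) (hMn : M < n)
    (h : n < lucky (M + 1)) (hB : sieveProd M < B) : (lucky n : ℝ) < n * B := by
  have h1 := lucky_le_mul_sieveProd hM hMn h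
  have h2 := two_le_sieveProd M
  have hn : (0 : ℝ) < n := by exact_mod_cast (by omega : 0 < n)
  have h3 : (n : ℝ) * sieveProd M < n * B := by gcongr
  linarith

theorem exists_lucky_le_lt_of_gt {n : ℕ} (hn : 3000 < n) :
    ∃ M, 21 ≤ M ∧ M < n ∧ lucky M ≤ n ∧ n < lucky (M + 1) := by
  obtain ⟨M, hM, hMn, h1, h2⟩ := exists_lucky_le_lt (n := n) (by omega)
  refine ⟨M, ?_, hMn, h1, h2⟩
  by_contra! h
  have := lucky_mono (m := M + 1) (n := 21) (by omega) (by omega)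
  have := lucky_twentyOne_le
  omega

theorem theorem2 :
    (∀ n : ℕ, 4 ≤ n → n ≤ 10 ^ 7 →
      (lucky n : ℝ) <
        (n : ℝ) * (Real.log n + (1 / 2 : ℝ) * (Real.log (Real.log n)) ^ 2 + 1)) ∧
    (∀ n : ℕ, 10 ^ 7 < n →
      (lucky n : ℝ) <
        (n : ℝ) * (Real.log n + (1 / 2 : ℝ) * (Real.log (Real.log n)) ^ 2
          + (1.238645 : ℝ) * Real.log (Real.log n) + (3.015516 : ℝ))) := by
  obtain ⟨hi, hs, -⟩ := initial_data.2.2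
  refine ⟨fun n h4 hn => ?_, fun n hn => ?_⟩
  · rcases le_or_gt n 3000 with h | h
    · exact lucky_lt_of_le h4 h
    · obtain ⟨M, hM, hMn, h1, h2⟩ := exists_lucky_le_lt_of_gt h
      refine lucky_lt_mul_of_sieveProd_lt (by omega) hMn h2 ?_
      have h3 : sieveProd M < mainTerm (Real.log (lucky M)) + 1 := by
        rcases le_or_gt M 30367 with hMN | hMN
        · exact hs.sieveProd_lt M hM hMN
        · exact sieveProd_lt_of_lucky_le hMN.le (h1.trans hn)
      have h5 := mainTerm_log_mono (three_le_lucky (by omega)) h1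
      simp only [mainTerm] at h3 h5
      linarith
  · obtain ⟨M, hM, hMn, h1, h2⟩ := exists_lucky_le_lt_of_gt (n := n) (by omega)
    refine lucky_lt_mul_of_sieveProd_lt (by omega) hMn h2 ?_
    have h0 := one_le_log_of_three_le (three_le_lucky (m := M) (by omega))
    have h0' : (0 : ℝ) < lucky M := by linarith [three_le_lucky_cast (m := M) (by omega)]
    have h3 : sieveProd M < mainTerm (Real.log (lucky M)) +
        1.238645 * Real.log (Real.log (lucky M)) + 3.015516 := by
      rcases le_or_gt M 30367 with hMN | hMN
      · have := hs.sieveProd_lt M hM hMN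
        have := Real.log_nonneg h0
        linarith
      · exact sieveProd_lt_of_le hMN.le
    have h5 := mainTerm_log_mono (three_le_lucky (by omega)) h1
    have h6 : Real.log (Real.log (lucky M)) ≤ Real.log (Real.log n) :=
      Real.log_le_log (by linarith) (Real.log_le_log h0' (by exact_mod_cast h1))
    simp only [mainTerm] at h3 h5
    linarith
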